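/- Let all function spaces be real-valued and let $H^2(\mathbb{R})$ be the Sobolev space of $f\in L^2(\mathbb{R})$ whose first two weak derivatives belong to $L^2(\mathbb{R})$. For $\gamma>4$ let $L_J(\gamma):(H^2(\mathbb{R}))^2\subset (L^2(\mathbb{R}))^2\to(L^2(\mathbb{R}))^2$ be the operator $$L_J(\gamma)=\begin{pmatrix}-\partial_\eta^2+\gamma-12\,\mathrm{sech}^2(\eta) & -4\sqrt{3(\gamma-4)}\,\mathrm{sech}(\eta)\\ -4\sqrt{3(\gamma-4)}\,\mathrm{sech}(\eta) & 12\left(-\partial_\eta^2+1-2\,\mathrm{sech}^2(\eta)\right)\end{pmatrix}.$$ An eigenvalue is called simple if its eigenspace is one-dimensional and it has no generalized eigenvectors other than eigenvectors. (i) For every $\gamma>4$, the operator $L_J(\gamma)$ has exactly one negative eigenvalue, this eigenvalue is simple, and $0$ is a simple eigenvalue of $L_J(\gamma)$. (ii) Let $\Omega<0$ and $c\in\mathbb{R}$ with $c/|\Omega|>4$, and let $$U(\xi)=-12\,\Omega\,\mathrm{sech}^2(\sqrt{-\Omega}\,\xi),\qquad A(\xi)=\sqrt{-12\,\Omega\,(c+4\Omega)}\;\mathrm{sech}(\sqrt{-\Omega}\,\xi)$$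 be the exact solution of $U''-cU+\tfrac12U^2+sA^2=0$, $A''+(\Omega+kU)A=0$ for $k=\tfrac16$, $s=1$. Let $$\mathcal{L}=-\begin{pmatrix}\partial_\xi^2+U-c & 2sA & 0\\ 2sA & \frac{2s}{k}(\partial_\xi^2+kU+\Omega) & 0\\ 0&0&\frac{2s}{k}(\partial_\xi^2+kU+\Omega)\end{pmatrix}$$ be the associated Hessian operator in $(L^2(\mathbb{R}))^3$ with domain $(H^2(\mathbb{R}))^3$, for $k=\tfrac16$, $s=1$. Then the Hessian constrained by the momentum $\frac12\int U^2\,d\xi$ and the mass $\frac{s}{k}\int A^2\,d\xi$ is nonnegative and degenerate only by the translational and rotational symmetries: every $f=(w,z_1,z_2)\in(H^2(\mathbb{R}))^3$ with $$\langle U,w\rangle=0,\qquad \langle A,z_1\rangle=0$$ satisfies $\langle\mathcal{L}f,f\rangle\ge 0$, and $\langle\mathcal{L}f,f\rangle=0$ if and only if $f$ is a linear combination of $(U',A',0)$ and $(0,0,A)$. -/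

import Mathlib

open MeasureTheory
open scoped ContDiff BoundedContinuousFunction RealInnerProductSpace

noncomputable section

/-- The real Hilbert space `L²(ℝ)`. -/
abbrev L2R : Type := Lp ℝ 2 (volume : Measure ℝ)

/-- `g ∈ L²(ℝ)` is the weak derivative of `f ∈ L²(ℝ)`. -/
def IsWeakDeriv (f g : L2R) : Prop :=
  ∀ φ : ℝ → ℝ, ContDiff ℝ ∞ φ → HasCompactSupport φ →
    ∫ x, f x * deriv φ x = -∫ x, g x * φ x

theorem L2R.integrable_mul (f : L2R) {φ : ℝ → ℝ} (hφ : Continuous φ)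
    (hc : HasCompactSupport φ) : Integrable (fun x => f x * φ x) :=
  (Lp.memLp f).integrable_mul (q := 2) (hφ.memLp_of_hasCompactSupport hc)

theorem IsWeakDeriv.zero : IsWeakDeriv 0 0 := by
  intro φ _ _
  have h : ∀ ψ : ℝ → ℝ, ∫ x, (0 : L2R) x * ψ x = 0 := by
    intro ψ
    refine integral_eq_zero_of_ae ?_
    filter_upwards [Lp.coeFn_zero ℝ 2 (volume : Measure ℝ)] with x hx
    rw [hx]
    simp
  rw [h, h, neg_zero]

theorem IsWeakDeriv.add {f g f' g' : L2R} (h : IsWeakDeriv f g) (h' : IsWeakDeriv f' g') :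
    IsWeakDeriv (f + f') (g + g') := by
  intro φ hφ hc
  have key : ∀ (a b : L2R) {ψ : ℝ → ℝ}, Continuous ψ → HasCompactSupport ψ →
      ∫ x, (a + b : L2R) x * ψ x = (∫ x, a x * ψ x) + ∫ x, b x * ψ x := by
    intro a b ψ h1 h2
    rw [← integral_add (a.integrable_mul h1 h2) (b.integrable_mul h1 h2)]
    refine integral_congr_ae ?_
    filter_upwards [Lp.coeFn_add a b] with x hx
    rw [hx, Pi.add_apply, add_mul]
  rw [key _ _ (hφ.continuous_deriv (by simp)) hc.deriv, key _ _ hφ.continuous hc,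
    h φ hφ hc, h' φ hφ hc]
  ring

theorem IsWeakDeriv.smul (r : ℝ) {f g : L2R} (h : IsWeakDeriv f g) :
    IsWeakDeriv (r • f) (r • g) := by
  intro φ hφ hc
  have key : ∀ (a : L2R) (ψ : ℝ → ℝ),
      ∫ x, (r • a : L2R) x * ψ x = r * ∫ x, a x * ψ x := by
    intro a ψ
    rw [← integral_const_mul]
    refine integral_congr_ae ?_
    filter_upwards [Lp.coeFn_smul r a] with x hx
    simp [hx, mul_assoc]
  rw [key, key, h φ hφ hc]
  ring

theorem IsWeakDeriv.unique {f g g' : L2R} (h : IsWeakDeriv f g) (h' : IsWeakDeriv f g') :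
    g = g' := by
  refine Lp.ext ?_
  refine ae_eq_of_integral_contDiff_smul_eq
    ((Lp.memLp g).locallyIntegrable (by norm_num))
    ((Lp.memLp g').locallyIntegrable (by norm_num)) ?_
  intro φ hφ hc
  have h1 := h φ hφ hc
  have h2 := h' φ hφ hc
  simp only [smul_eq_mul, mul_comm (φ _)]
  linarith

/-- The Sobolev space `H²(ℝ)`: both weak derivatives exist in `L²(ℝ)`. -/
def H2R : Submodule ℝ L2R where
  carrier := {f | ∃ g h : L2R, IsWeakDeriv f g ∧ IsWeakDeriv g h}
  zero_mem' := ⟨0, 0, .zero, .zero⟩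
  add_mem' := by
    rintro f f' ⟨g, h, hg, hh⟩ ⟨g', h', hg', hh'⟩
    exact ⟨g + g', h + h', hg.add hg', hh.add hh'⟩
  smul_mem' := by
    rintro r f ⟨g, h, hg, hh⟩
    exact ⟨r • g, r • h, hg.smul r, hh.smul r⟩

theorem H2R.exists_deriv2 (f : H2R) :
    ∃ h : L2R, ∃ g : L2R, IsWeakDeriv (f : L2R) g ∧ IsWeakDeriv g h := by
  obtain ⟨g, h, hg, hh⟩ := f.2
  exact ⟨h, g, hg, hh⟩

theorem H2R.deriv2_unique {f g h g' h' : L2R} (h1 : IsWeakDeriv f g) (h2 : IsWeakDeriv g h)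
    (h1' : IsWeakDeriv f g') (h2' : IsWeakDeriv g' h') : h = h' := by
  obtain rfl := h1.unique h1'
  exact h2.unique h2'

/-- The second weak derivative `∂² : H²(ℝ) → L²(ℝ)`. -/
def deriv2 : H2R →ₗ[ℝ] L2R where
  toFun f := (H2R.exists_deriv2 f).choose
  map_add' f f' := by
    obtain ⟨g, hg, hh⟩ := (H2R.exists_deriv2 f).choose_spec
    obtain ⟨g', hg', hh'⟩ := (H2R.exists_deriv2 f').choose_spec
    obtain ⟨k, hk, hl⟩ := (H2R.exists_deriv2 (f + f')).choose_spec
    exact H2R.deriv2_unique hk hl (hg.add hg') (hh.add hh')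
  map_smul' r f := by
    obtain ⟨g, hg, hh⟩ := (H2R.exists_deriv2 f).choose_spec
    obtain ⟨k, hk, hl⟩ := (H2R.exists_deriv2 (r • f)).choose_spec
    exact H2R.deriv2_unique hk hl (hg.smul r) (hh.smul r)

theorem deriv2_spec (f : H2R) : ∃ g : L2R, IsWeakDeriv (f : L2R) g ∧ IsWeakDeriv g (deriv2 f) :=
  (H2R.exists_deriv2 f).choose_spec

theorem memLp_bcf_mul (V : ℝ →ᵇ ℝ) (f : L2R) : MemLp (fun x => V x * f x) 2 volume :=
  (Lp.memLp f).of_le_mul (c := ‖V‖)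
    (V.continuous.aestronglyMeasurable.mul (Lp.aestronglyMeasurable f))
    (Filter.Eventually.of_forall fun x => by
      rw [norm_mul]
      exact mul_le_mul_of_nonneg_right (V.norm_coe_le_norm x) (norm_nonneg _))

/-- Multiplication by a bounded continuous function, as an operator on `L²(ℝ)`. -/
def mulOp (V : ℝ →ᵇ ℝ) : L2R →ₗ[ℝ] L2R where
  toFun f := (memLp_bcf_mul V f).toLp
  map_add' f g := by
    rw [← MemLp.toLp_add]
    refine MemLp.toLp_congr _ _ ?_
    filter_upwards [Lp.coeFn_add f g] with x hx
    rw [hx]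
    simp only [Pi.add_apply]
    rw [mul_add]
  map_smul' r f := by
    rw [RingHom.id_apply, ← MemLp.toLp_const_smul]
    refine MemLp.toLp_congr _ _ ?_
    filter_upwards [Lp.coeFn_smul r f] with x hx
    simp [hx, mul_left_comm]

/-- The real Hilbert space `(L²(ℝ))ⁿ`. -/
abbrev L2Rn (n : ℕ) : Type := PiLp 2 (fun _ : Fin n => L2R)

/-- The Sobolev space `(H²(ℝ))ⁿ`. -/
def H2Rn (n : ℕ) : Submodule ℝ (L2Rn n) where
  carrier := {f | ∀ i, f i ∈ H2R}
  zero_mem' := fun _ => H2R.zero_mem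
  add_mem' := fun hf hg i => H2R.add_mem (hf i) (hg i)
  smul_mem' := fun r _ hf i => H2R.smul_mem r (hf i)

/-- The matrix Schrödinger operator `diag(-d₁∂², …, -dₙ∂²) + V` in `(L²(ℝ))ⁿ`, with
domain `(H²(ℝ))ⁿ`. -/
def matrixSchrodinger {n : ℕ} (d : Fin n → ℝ) (V : Matrix (Fin n) (Fin n) (ℝ →ᵇ ℝ)) :
    L2Rn n →ₗ.[ℝ] L2Rn n where
  domain := H2Rn n
  toFun :=
    { toFun := fun f => WithLp.toLp 2 fun i =>
        -(d i • deriv2 ⟨(f : L2Rn n) i, f.2 i⟩) + ∑ j, mulOp (V i j) ((f : L2Rn n) j)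
      map_add' := by
        intro f g
        ext1 i
        have h : deriv2 ⟨((f + g : H2Rn n) : L2Rn n) i, (f + g).2 i⟩ =
            deriv2 ⟨(f : L2Rn n) i, f.2 i⟩ + deriv2 ⟨(g : L2Rn n) i, g.2 i⟩ :=
          deriv2.map_add ⟨(f : L2Rn n) i, f.2 i⟩ ⟨(g : L2Rn n) i, g.2 i⟩
        have h' : ∀ j, mulOp (V i j) (((f + g : H2Rn n) : L2Rn n) j) =
            mulOp (V i j) ((f : L2Rn n) j) + mulOp (V i j) ((g : L2Rn n) j) :=
          fun j => (mulOp (V i j)).map_add _ _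
        simp only [PiLp.add_apply]
        rw [h, Finset.sum_congr rfl fun j _ => h' j, Finset.sum_add_distrib, smul_add]
        abel
      map_smul' := by
        intro r f
        ext1 i
        have h : deriv2 ⟨((r • f : H2Rn n) : L2Rn n) i, (r • f).2 i⟩ =
            r • deriv2 ⟨(f : L2Rn n) i, f.2 i⟩ :=
          deriv2.map_smul r ⟨(f : L2Rn n) i, f.2 i⟩
        have h' : ∀ j, mulOp (V i j) (((r • f : H2Rn n) : L2Rn n) j) =
            r • mulOp (V i j) ((f : L2Rn n) j) :=
          fun j => (mulOp (V i j)).map_smul _ _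
        simp only [PiLp.smul_apply, RingHom.id_apply]
        rw [h, Finset.sum_congr rfl fun j _ => h' j, ← Finset.smul_sum, smul_add, smul_neg,
          smul_comm (d i) r] }

section Eigenvalues

variable {E : Type*} [AddCommGroup E] [Module ℝ E]

/-- The space of solutions `x` in the domain of `T` of `T x = μ x`. -/
def opEigenspace (T : E →ₗ.[ℝ] E) (μ : ℝ) : Submodule ℝ E where
  carrier := {x | ∃ y : T.domain, (y : E) = x ∧ T y = μ • x}
  zero_mem' := ⟨0, rfl, by simp⟩
  add_mem' := by
    rintro x x' ⟨y, rfl, hy⟩ ⟨y', rfl, hy'⟩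
    exact ⟨y + y', rfl, by rw [LinearPMap.map_add, hy, hy', smul_add]⟩
  smul_mem' := by
    rintro r x ⟨y, rfl, hy⟩
    exact ⟨r • y, rfl, by rw [LinearPMap.map_smul, hy, smul_comm]⟩

/-- `μ` is an eigenvalue of `T`. -/
def IsEigenvalue (T : E →ₗ.[ℝ] E) (μ : ℝ) : Prop := opEigenspace T μ ≠ ⊥

/-- `μ` is a simple eigenvalue of `T`: the eigenspace is one-dimensional, and there are no
generalized eigenvectors other than eigenvectors. -/
def IsSimpleEigenvalue (T : E →ₗ.[ℝ] E) (μ : ℝ) : Prop :=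
  Module.finrank ℝ (opEigenspace T μ) = 1 ∧
    ∀ x : T.domain, T x - μ • (x : E) ∈ opEigenspace T μ → T x - μ • (x : E) = 0

end Eigenvalues

/-- The bounded continuous function `ξ ↦ sech (b ξ)`. -/
def sechB (b : ℝ) : ℝ →ᵇ ℝ :=
  BoundedContinuousFunction.ofNormedAddCommGroup (fun ξ => 1 / Real.cosh (b * ξ))
    (continuous_const.div (Real.continuous_cosh.comp (continuous_const.mul continuous_id))
      fun _ => (Real.cosh_pos _).ne') 1
    (fun ξ => by
      rw [Real.norm_of_nonneg (by positivity)]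
      exact (div_le_one (Real.cosh_pos _)).2 (Real.one_le_cosh _))

/-- The normalized Hessian block `L_J(γ)`. -/
def normalizedHessianBlock (γ : ℝ) : L2Rn 2 →ₗ.[ℝ] L2Rn 2 :=
  matrixSchrodinger ![1, 12]
    !![γ • 1 - (12 : ℝ) • sechB 1 ^ 2, (-(4 * √(3 * (γ - 4)))) • sechB 1;
       (-(4 * √(3 * (γ - 4)))) • sechB 1, (12 : ℝ) • (1 - (2 : ℝ) • sechB 1 ^ 2)]

/-- The Hessian operator `𝓛` of the action functional at a profile `(U, A)`, acting on
perturbations `(w, z₁, z₂)`. -/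
def hessian (k s c Ω : ℝ) (U A : ℝ →ᵇ ℝ) : L2Rn 3 →ₗ.[ℝ] L2Rn 3 :=
  matrixSchrodinger ![1, 2 * s / k, 2 * s / k]
    !![c • 1 - U, (-(2 * s)) • A, 0;
       (-(2 * s)) • A, (2 * s / k) • (-(Ω • 1) - k • U), 0;
       0, 0, (2 * s / k) • (-(Ω • 1) - k • U)]

/-- The component `U(ξ) = -12 Ω sech²(√(-Ω) ξ)` of the exact solution. -/
def exactU (Ω : ℝ) : ℝ →ᵇ ℝ := (-12 * Ω) • sechB (√(-Ω)) ^ 2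

/-- The component `A(ξ) = √(-12 Ω (c + 4 Ω)) sech(√(-Ω) ξ)` of the exact solution, for `s = 1`. -/
def exactA (c Ω : ℝ) : ℝ →ᵇ ℝ := √(-12 * Ω * (c + 4 * Ω)) • sechB (√(-Ω))

end

/-!
Everything rests on one identity for the quadratic form. Put `S = sech (b x)`, `T = tanh (b x)` and
consider the block with diagonal `-∂² + c - 12 b² S²` and `12 (-∂² + b² - 2 b² S²)` and off-diagonal
entries `-12 ρ S`, where `3 ρ² = b² (c - 4 b²)`. The operator `L_J(γ)` is the case `b = 1`, `c = γ`;
the Hessian at the exact solution is the case `b = √(-Ω)` (then `U = 12 b² S²` and `A = 6 ρ S`),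
together with a decoupled scalar operator. If `w` is orthogonal to `S²`, then `w = u' - 2 b T u` for
some `u ∈ H¹`, because `S²` spans the orthogonal complement of the closed range of `∂ - 2 b T`
(`exists_firstOrder_solution`). With `r = u' + 2 b T u`, the form at `(w, z)` equals
`∫ (r'² + c r² + 12 (z' + b T z + ρ S u)²)` (`integral_blockDensity`): this is the factorization
of Pöschl–Teller operators through first order operators, with the coupling absorbed in the last
square. So the form is nonnegative on the hyperplane `⟪S², w⟫ = 0`, and it vanishes there exactly on
the span of the translation mode, where `u` is a multiple of `S²`, and the vector `(0, S)`.

For the constrained Hessian, the constraint on `z₁` excludes `(0, S)`, and the scalar operator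
`-∂² + b² - 2 b² S² = (∂ + b T)* (∂ + b T)` contributes the rotation mode.

For `L_J(γ)`, nonnegativity on a hyperplane shows that there is at most one negative eigenvalue and
that it is simple (`exists_unique_simple_neg_eigenvalue`). The form is negative at
`(S², ρ / 4 S)` (`integral_blockDensity_neg`), so the infimum `μ` of the Rayleigh quotient is
negative. The infimum is attained without any compact embedding: the form minus `μ` times the mass
is nonnegative, and on the hyperplane it is coercive, so the parallelogram inequality makes
minimizing sequences converge after extraction (`exists_neg_weak_eigenvalue`). A kernel element lies on the
hyperplane, since otherwise moving it along the negative direction would produce a negative value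
there; hence it is a combination of the translation mode and `(0, S)`, and the first component of
the equation excludes the latter.

The analysis of weak derivatives is reduced to the du Bois-Reymond lemma
(`ae_eq_const_of_integral_mul_deriv_eq_zero`), which determines the weak solutions of scalar first
order equations. Integration by parts in `H¹(ℝ)` follows from it by Hilbert space geometry: an
element of `H¹(ℝ)` orthogonal to the test functions solves `f'' = f` and therefore vanishes.
-/

/-! ### The du Bois-Reymond lemma -/

/-- A smooth compactly supported function of integral zero is the derivative of another one. -/
theorem exists_deriv_eq_of_integral_eq_zero {θ : ℝ → ℝ} (hθ : ContDiff ℝ ∞ θ)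
    (hc : HasCompactSupport θ) (h0 : ∫ x, θ x = 0) :
    ∃ Θ : ℝ → ℝ, ContDiff ℝ ∞ Θ ∧ HasCompactSupport Θ ∧ deriv Θ = θ := by
  obtain ⟨R, hR⟩ : ∃ R : ℝ, ∀ x, R < |x| → θ x = 0 := by
    obtain ⟨R, hR⟩ := hc.isCompact.isBounded.subset_closedBall (0 : ℝ)
    refine ⟨R, fun x hx => ?_⟩
    by_contra hne
    have := hR (subset_tsupport θ hne)
    rw [mem_closedBall_zero_iff, Real.norm_eq_abs] at this
    linarith
  have hint : Integrable θ := hθ.continuous.integrable_of_hasCompactSupport hc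
  have hd : ∀ x, HasDerivAt (fun x => ∫ t in Set.Iic x, θ t) (θ x) x := by
    intro x
    have h1 : ∀ y, ∫ t in Set.Iic y, θ t =
        (∫ t in Set.Iic (0 : ℝ), θ t) + ∫ t in (0 : ℝ)..y, θ t := by
      intro y
      rw [← intervalIntegral.integral_Iic_sub_Iic hint.integrableOn hint.integrableOn]
      ring
    have h2 := (intervalIntegral.integral_hasDerivAt_right
      (hint.intervalIntegrable (a := 0) (b := x))
      (hθ.continuous.stronglyMeasurableAtFilter _ _) hθ.continuous.continuousAt).const_add
        (∫ t in Set.Iic (0 : ℝ), θ t)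
    exact h2.congr_of_eventuallyEq (Filter.Eventually.of_forall h1)
  have hde : deriv (fun x => ∫ t in Set.Iic x, θ t) = θ := funext fun x => (hd x).deriv
  refine ⟨fun x => ∫ t in Set.Iic x, θ t, ?_, ?_, hde⟩
  · rw [contDiff_infty_iff_deriv, hde]
    exact ⟨fun x => (hd x).differentiableAt, hθ⟩
  · refine HasCompactSupport.of_support_subset_isCompact (isCompact_Icc (a := -|R|) (b := |R|)) ?_
    intro x hx
    by_contra hxR
    apply hx
    simp only [Set.mem_Icc, not_and_or, not_le] at hxR
    rcases hxR with h | h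
    · refine setIntegral_eq_zero_of_forall_eq_zero fun t ht => hR t ?_
      have : t ≤ x := ht
      rw [abs_of_neg (by linarith [abs_nonneg R])]
      linarith [le_abs_self R]
    · show ∫ t in Set.Iic x, θ t = 0
      rw [← h0]
      refine setIntegral_eq_integral_of_forall_compl_eq_zero fun t ht => hR t ?_
      have : x < t := not_le.1 ht
      linarith [le_abs_self R, le_abs_self t]

/-- The du Bois-Reymond lemma on the line: a locally integrable function whose distributional
derivative vanishes is constant. -/
theorem ae_eq_const_of_integral_mul_deriv_eq_zero {h : ℝ → ℝ} (hl : LocallyIntegrable h)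
    (h0 : ∀ φ : ℝ → ℝ, ContDiff ℝ ∞ φ → HasCompactSupport φ → ∫ x, h x * deriv φ x = 0) :
    ∃ c : ℝ, ∀ᵐ x, h x = c := by
  let B : ContDiffBump (0 : ℝ) := ⟨1, 2, one_pos, one_lt_two⟩
  set ψ : ℝ → ℝ := B.normed volume with hψdef
  have hψ : ContDiff ℝ ∞ ψ := B.contDiff_normed
  have hψc : HasCompactSupport ψ := B.hasCompactSupport_normed
  have hψ1 : ∫ x, ψ x = 1 := B.integral_normed
  refine ⟨∫ x, h x * ψ x, ?_⟩
  refine ae_eq_of_integral_contDiff_smul_eq hl (locallyIntegrable_const _) ?_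
  intro φ hφ hφc
  have hI : ∀ {χ : ℝ → ℝ}, ContDiff ℝ ∞ χ → HasCompactSupport χ →
      Integrable (fun x => h x * χ x) := by
    intro χ h1 h2
    have := hl.integrable_smul_right_of_hasCompactSupport h1.continuous h2
    simpa [mul_comm] using this
  have hφi : Integrable φ := hφ.continuous.integrable_of_hasCompactSupport hφc
  have hψi : Integrable ψ := hψ.continuous.integrable_of_hasCompactSupport hψc
  -- Subtracting `(∫ φ) ψ` makes the integral vanish, so that `h` can be tested against a primitive.
  obtain ⟨Θ, hΘ, hΘc, hΘd⟩ := exists_deriv_eq_of_integral_eq_zero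
    (θ := fun x => φ x - (∫ y, φ y) * ψ x) (hφ.sub (contDiff_const.mul hψ))
    (hφc.sub (hψc.mul_left (f := fun _ => ∫ y, φ y))) (by
      rw [integral_sub hφi (hψi.const_mul _), integral_const_mul, hψ1]; ring)
  have key := h0 Θ hΘ hΘc
  rw [hΘd] at key
  have : ∀ x, h x * (φ x - (∫ y, φ y) * ψ x) = h x * φ x - (∫ y, φ y) * (h x * ψ x) := by
    intro x; ring
  simp only [this] at key
  rw [integral_sub (hI hφ hφc) ((hI hψ hψc).const_mul _), integral_const_mul] at key
  simp only [smul_eq_mul, mul_comm (φ _)]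
  rw [integral_const_mul]
  linarith

/-! ### Weak derivatives and smooth multipliers -/

/-- `g` is the weak derivative of `f`, and both are square integrable: the function-level form of
`IsWeakDeriv`, in which products can be taken pointwise. -/
structure WeakDerivL2 (f g : ℝ → ℝ) : Prop where
  memLp : MemLp f 2 volume
  memLp_deriv : MemLp g 2 volume
  integral_mul_deriv : ∀ φ : ℝ → ℝ, ContDiff ℝ ∞ φ → HasCompactSupport φ →
    ∫ x, f x * deriv φ x = -∫ x, g x * φ x

theorem IsWeakDeriv.weakDerivL2 {f g : L2R} (h : IsWeakDeriv f g) : WeakDerivL2 f g :=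
  ⟨Lp.memLp f, Lp.memLp g, h⟩

theorem integrable_mul_test {f : ℝ → ℝ} (hf : MemLp f 2 volume) {φ : ℝ → ℝ} (hφ : Continuous φ)
    (hc : HasCompactSupport φ) : Integrable (fun x => f x * φ x) :=
  hf.integrable_mul (q := 2) (hφ.memLp_of_hasCompactSupport hc)

theorem WeakDerivL2.congr {f g f' g' : ℝ → ℝ} (h : WeakDerivL2 f g) (hf : f =ᵐ[volume] f')
    (hg : g =ᵐ[volume] g') : WeakDerivL2 f' g' := by
  refine ⟨h.memLp.ae_eq hf, h.memLp_deriv.ae_eq hg, fun φ hφ hc => ?_⟩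
  have := h.integral_mul_deriv φ hφ hc
  rwa [integral_congr_ae (g := fun x => f' x * deriv φ x)
      (by filter_upwards [hf] with x hx; rw [hx]),
    integral_congr_ae (f := fun x => g x * φ x) (g := fun x => g' x * φ x)
      (by filter_upwards [hg] with x hx; rw [hx])] at this

theorem WeakDerivL2.isWeakDeriv {f g : ℝ → ℝ} (h : WeakDerivL2 f g) {F G : L2R}
    (hF : F =ᵐ[volume] f) (hG : G =ᵐ[volume] g) : IsWeakDeriv F G :=
  (h.congr hF.symm hG.symm).integral_mul_deriv

theorem WeakDerivL2.add {f g f' g' : ℝ → ℝ} (h : WeakDerivL2 f g) (h' : WeakDerivL2 f' g') :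
    WeakDerivL2 (fun x => f x + f' x) (fun x => g x + g' x) := by
  refine ⟨h.memLp.add h'.memLp, h.memLp_deriv.add h'.memLp_deriv, fun φ hφ hc => ?_⟩
  simp only [add_mul]
  rw [integral_add (integrable_mul_test h.memLp (hφ.continuous_deriv (by simp)) hc.deriv)
      (integrable_mul_test h'.memLp (hφ.continuous_deriv (by simp)) hc.deriv),
    integral_add (integrable_mul_test h.memLp_deriv hφ.continuous hc)
      (integrable_mul_test h'.memLp_deriv hφ.continuous hc),
    h.integral_mul_deriv φ hφ hc, h'.integral_mul_deriv φ hφ hc]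
  ring

theorem WeakDerivL2.const_mul {f g : ℝ → ℝ} (h : WeakDerivL2 f g) (r : ℝ) :
    WeakDerivL2 (fun x => r * f x) (fun x => r * g x) := by
  refine ⟨h.memLp.const_mul r, h.memLp_deriv.const_mul r, fun φ hφ hc => ?_⟩
  simp only [mul_assoc, integral_const_mul, h.integral_mul_deriv φ hφ hc]
  ring

/-- A bounded smooth function `a` with bounded derivative `a'`: a multiplier of `H¹(ℝ)`. -/
structure BddSmooth (a a' : ℝ → ℝ) : Prop where
  contDiff : ContDiff ℝ ∞ a
  hasDerivAt : ∀ x, HasDerivAt a (a' x) x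
  bdd : ∃ C, ∀ x, |a x| ≤ C
  bdd_deriv : ∃ C, ∀ x, |a' x| ≤ C

theorem BddSmooth.continuous_deriv {a a' : ℝ → ℝ} (h : BddSmooth a a') : Continuous a' := by
  have : a' = deriv a := funext fun x => (h.hasDerivAt x).deriv.symm
  rw [this]
  exact h.contDiff.continuous_deriv (by simp)

theorem BddSmooth.const (r : ℝ) : BddSmooth (fun _ => r) (fun _ => 0) :=
  ⟨contDiff_const, fun x => hasDerivAt_const x r, ⟨|r|, fun _ => le_rfl⟩, ⟨0, fun _ => by simp⟩⟩

theorem BddSmooth.add {a a' c c' : ℝ → ℝ} (h : BddSmooth a a') (k : BddSmooth c c') :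
    BddSmooth (fun x => a x + c x) (fun x => a' x + c' x) := by
  obtain ⟨A, hA⟩ := h.bdd
  obtain ⟨A', hA'⟩ := h.bdd_deriv
  obtain ⟨C, hC⟩ := k.bdd
  obtain ⟨C', hC'⟩ := k.bdd_deriv
  exact ⟨h.contDiff.add k.contDiff, fun x => (h.hasDerivAt x).add (k.hasDerivAt x),
    ⟨A + C, fun x => (abs_add_le _ _).trans (add_le_add (hA x) (hC x))⟩,
    ⟨A' + C', fun x => (abs_add_le _ _).trans (add_le_add (hA' x) (hC' x))⟩⟩

theorem abs_mul_le_of_le {p q A C : ℝ} (hp : |p| ≤ A) (hq : |q| ≤ C) : |p * q| ≤ A * C := by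
  rw [abs_mul]
  exact mul_le_mul hp hq (abs_nonneg _) ((abs_nonneg _).trans hp)

theorem BddSmooth.mul {a a' c c' : ℝ → ℝ} (h : BddSmooth a a') (k : BddSmooth c c') :
    BddSmooth (fun x => a x * c x) (fun x => a' x * c x + a x * c' x) := by
  obtain ⟨A, hA⟩ := h.bdd
  obtain ⟨A', hA'⟩ := h.bdd_deriv
  obtain ⟨C, hC⟩ := k.bdd
  obtain ⟨C', hC'⟩ := k.bdd_deriv
  exact ⟨h.contDiff.mul k.contDiff, fun x => (h.hasDerivAt x).mul (k.hasDerivAt x),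
    ⟨A * C, fun x => abs_mul_le_of_le (hA x) (hC x)⟩,
    ⟨A' * C + A * C', fun x => (abs_add_le _ _).trans
      (add_le_add (abs_mul_le_of_le (hA' x) (hC x)) (abs_mul_le_of_le (hA x) (hC' x)))⟩⟩

theorem memLp_bdd_mul {a f : ℝ → ℝ} (ha : Continuous a) (hb : ∃ C, ∀ x, |a x| ≤ C)
    (hf : MemLp f 2 volume) : MemLp (fun x => a x * f x) 2 volume := by
  obtain ⟨C, hC⟩ := hb
  refine hf.of_le_mul (c := C) (ha.aestronglyMeasurable.mul hf.1)
    (Filter.Eventually.of_forall fun x => ?_)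
  rw [norm_mul]
  exact mul_le_mul_of_nonneg_right (hC x) (norm_nonneg _)

theorem BddSmooth.memLp_mul {a a' f : ℝ → ℝ} (h : BddSmooth a a') (hf : MemLp f 2 volume) :
    MemLp (fun x => a x * f x) 2 volume :=
  memLp_bdd_mul h.contDiff.continuous h.bdd hf

theorem BddSmooth.memLp_deriv_mul {a a' f : ℝ → ℝ} (h : BddSmooth a a') (hf : MemLp f 2 volume) :
    MemLp (fun x => a' x * f x) 2 volume :=
  memLp_bdd_mul h.continuous_deriv h.bdd_deriv hf

theorem BddSmooth.integrable_mul_mul {a a' f g : ℝ → ℝ} (h : BddSmooth a a')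
    (hf : MemLp f 2 volume) (hg : MemLp g 2 volume) : Integrable (fun x => a x * f x * g x) :=
  (h.memLp_mul hf).integrable_mul (q := 2) hg

/-- The Leibniz rule for a smooth multiplier. -/
theorem WeakDerivL2.smooth_mul {f g a a' : ℝ → ℝ} (h : WeakDerivL2 f g) (k : BddSmooth a a') :
    WeakDerivL2 (fun x => a x * f x) (fun x => a' x * f x + a x * g x) := by
  refine ⟨k.memLp_mul h.memLp, (k.memLp_deriv_mul h.memLp).add (k.memLp_mul h.memLp_deriv),
    fun φ hφ hc => ?_⟩
  have h1 := h.integral_mul_deriv (fun x => a x * φ x) (k.contDiff.mul hφ) hc.mul_left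
  have hd : ∀ x, deriv (fun x => a x * φ x) x = a' x * φ x + a x * deriv φ x := fun x =>
    ((k.hasDerivAt x).mul (hφ.differentiable (by simp) x).hasDerivAt).deriv
  simp only [hd] at h1
  have e1 : ∀ x, f x * (a' x * φ x + a x * deriv φ x) =
      a' x * f x * φ x + a x * f x * deriv φ x := fun x => by ring
  have e2 : ∀ x, (a' x * f x + a x * g x) * φ x = a' x * f x * φ x + g x * (a x * φ x) :=
    fun x => by ring
  have i1 := integrable_mul_test (k.memLp_deriv_mul h.memLp) hφ.continuous hc
  have i2 := integrable_mul_test (k.memLp_mul h.memLp) (hφ.continuous_deriv (by simp)) hc.deriv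
  have i3 : Integrable (fun x => g x * (a x * φ x)) :=
    integrable_mul_test h.memLp_deriv (k.contDiff.continuous.mul hφ.continuous)
    (hc.mul_left (f := a))
  simp only [e1] at h1
  rw [integral_add i1 i2] at h1
  simp only [e2]
  rw [integral_add i1 i3]
  linarith

/-- A classical derivative is a weak derivative. -/
theorem WeakDerivL2.of_hasDerivAt {f g : ℝ → ℝ} (hd : ∀ x, HasDerivAt f (g x) x)
    (hf : MemLp f 2 volume) (hg : MemLp g 2 volume) : WeakDerivL2 f g := by
  refine ⟨hf, hg, fun φ hφ hc => ?_⟩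
  exact integral_mul_deriv_eq_deriv_mul_of_integrable (fun x _ => hd x)
    (fun x _ => (hφ.differentiable (by simp) x).hasDerivAt)
    (integrable_mul_test hf (hφ.continuous_deriv (by simp)) hc.deriv)
    (integrable_mul_test hg hφ.continuous hc) (integrable_mul_test hf hφ.continuous hc)

/-- A weak solution of the scalar linear equation `f' = k f` is a multiple of a nowhere vanishing
classical solution `E`, because `f / E` has vanishing weak derivative. -/
theorem WeakDerivL2.ae_eq_const_mul {f g k E : ℝ → ℝ} (h : WeakDerivL2 f g)
    (hE : ContDiff ℝ ∞ E) (hE0 : ∀ x, E x ≠ 0) (hE' : ∀ x, HasDerivAt E (k x * E x) x)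
    (hg : ∀ᵐ x, g x = k x * f x) : ∃ c : ℝ, ∀ᵐ x, f x = c * E x := by
  have hinv : ContDiff ℝ ∞ fun x => (E x)⁻¹ := hE.inv hE0
  have hl : LocallyIntegrable (fun x => f x * (E x)⁻¹) := by
    have hf : LocallyIntegrable f := h.memLp.locallyIntegrable (by norm_num)
    have := hf.smul_continuous hinv.continuous
    simpa [mul_comm] using this
  obtain ⟨c, hc⟩ := ae_eq_const_of_integral_mul_deriv_eq_zero hl fun φ hφ hφc => by
    have hc' : HasCompactSupport fun x => (E x)⁻¹ * φ x := hφc.mul_left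
    have h1 := h.integral_mul_deriv (fun x => (E x)⁻¹ * φ x) (hinv.mul hφ) hc'
    have hd : ∀ x, deriv (fun x => (E x)⁻¹ * φ x) x =
        -(k x * ((E x)⁻¹ * φ x)) + (E x)⁻¹ * deriv φ x := fun x => by
      have := (((hE' x).inv (hE0 x)).mul (hφ.differentiable (by simp) x).hasDerivAt).deriv
      refine this.trans ?_
      have := hE0 x
      simp only [Pi.inv_apply]
      field_simp
    have e : ∀ᵐ x, g x * ((E x)⁻¹ * φ x) + f x * deriv (fun x => (E x)⁻¹ * φ x) x =
        f x * (E x)⁻¹ * deriv φ x := by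
      filter_upwards [hg] with x hx
      rw [hd, hx]
      ring
    rw [← integral_congr_ae e, integral_add, h1]
    · ring
    · exact integrable_mul_test h.memLp_deriv (hinv.mul hφ).continuous hc'
    · exact integrable_mul_test h.memLp ((hinv.mul hφ).continuous_deriv (by simp)) hc'.deriv
  refine ⟨c, ?_⟩
  filter_upwards [hc] with x hx
  have := hE0 x
  rw [← hx]
  field_simp

/-- Square integrable solutions of `f' = s f` with `s ≠ 0` vanish. -/
theorem WeakDerivL2.ae_eq_zero_of_deriv_eq_const_mul {f g : ℝ → ℝ} (h : WeakDerivL2 f g) {s : ℝ}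
    (hs : s ≠ 0) (hg : ∀ᵐ x, g x = s * f x) : ∀ᵐ x, f x = 0 := by
  have hder : ∀ t x : ℝ, HasDerivAt (fun x => Real.exp (t * x)) (t * Real.exp (t * x)) x := by
    intro t x
    have := ((hasDerivAt_id x).const_mul t).exp
    simpa [mul_comm] using this
  obtain ⟨c, hc⟩ := h.ae_eq_const_mul (k := fun _ => s) (E := fun x => Real.exp (s * x))
    (by fun_prop) (fun x => (Real.exp_pos _).ne') (hder s) hg
  have h2 : Integrable (fun x => c ^ 2 * Real.exp ((2 * s) * x)) := by
    refine h.memLp.integrable_sq.congr ?_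
    filter_upwards [hc] with x hx
    rw [hx, mul_pow, ← Real.exp_nat_mul]
    congr 2
    push_cast
    ring
  have h3 := integral_eq_zero_of_hasDerivAt_of_integrable
    (fun x => (hder (2 * s) x).const_mul (c ^ 2))
    ((h2.const_mul (2 * s)).congr (Filter.Eventually.of_forall fun x => by simp only; ring)) h2
  -- If `c exp (s x)` were square integrable with `c ≠ 0`, then `exp (2 s x)` and its derivative
  -- would be integrable, so that the integral of the derivative would vanish.
  have h4 : ∫ x, c ^ 2 * Real.exp ((2 * s) * x) = 0 := by
    have e : ∀ x, c ^ 2 * (2 * s * Real.exp (2 * s * x)) =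
        2 * s * (c ^ 2 * Real.exp (2 * s * x)) := fun x => by ring
    simp only [e] at h3
    rw [integral_const_mul] at h3
    exact (mul_eq_zero.1 h3).resolve_left (by simpa using hs)
  rw [integral_eq_zero_iff_of_nonneg (fun x => by positivity) h2] at h4
  filter_upwards [hc, h4] with x hx hx'
  have h5 : c ^ 2 = 0 := (mul_eq_zero.1 hx').resolve_right (Real.exp_pos _).ne'
  rw [hx, pow_eq_zero_iff two_ne_zero |>.1 h5, zero_mul]

/-! ### The Hilbert space `H¹(ℝ)` and integration by parts -/

theorem L2R.inner_eq_integral (f g : L2R) : ⟪f, g⟫ = ∫ x, f x * g x := by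
  rw [L2.inner_def]
  refine integral_congr_ae (Filter.Eventually.of_forall fun x => ?_)
  simp [mul_comm]

theorem L2R.inner_toLp (f : L2R) {g : ℝ → ℝ} (hg : MemLp g 2 volume) :
    ⟪f, hg.toLp g⟫ = ∫ x, f x * g x := by
  rw [L2R.inner_eq_integral]
  refine integral_congr_ae ?_
  filter_upwards [hg.coeFn_toLp] with x hx
  rw [hx]

theorem memLp_deriv_test {φ : ℝ → ℝ} (hφ : ContDiff ℝ ∞ φ) (hc : HasCompactSupport φ) :
    MemLp (deriv φ) 2 volume :=
  (hφ.continuous_deriv (by simp)).memLp_of_hasCompactSupport hc.deriv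

theorem memLp_test {φ : ℝ → ℝ} (hφ : ContDiff ℝ ∞ φ) (hc : HasCompactSupport φ) :
    MemLp φ 2 volume := hφ.continuous.memLp_of_hasCompactSupport hc

theorem isWeakDeriv_test {φ : ℝ → ℝ} (hφ : ContDiff ℝ ∞ φ) (hc : HasCompactSupport φ) :
    IsWeakDeriv ((memLp_test hφ hc).toLp φ) ((memLp_deriv_test hφ hc).toLp (deriv φ)) :=
  (WeakDerivL2.of_hasDerivAt (fun x => (hφ.differentiable (by simp) x).hasDerivAt)
    (memLp_test hφ hc) (memLp_deriv_test hφ hc)).isWeakDeriv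
    (MemLp.coeFn_toLp _) (MemLp.coeFn_toLp _)

theorem isWeakDeriv_iff_inner {f g : L2R} : IsWeakDeriv f g ↔
    ∀ (φ : ℝ → ℝ) (hφ : ContDiff ℝ ∞ φ) (hc : HasCompactSupport φ),
      ⟪f, (memLp_deriv_test hφ hc).toLp (deriv φ)⟫ = -⟪g, (memLp_test hφ hc).toLp φ⟫ := by
  simp only [L2R.inner_toLp, IsWeakDeriv]

/-- The Sobolev space `H¹(ℝ)` with its Hilbert norm, encoded as the closed space of pairs
`(f, f')` in `L² × L²`. -/
def H1R : Submodule ℝ (WithLp 2 (L2R × L2R)) where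
  carrier := {p | IsWeakDeriv p.fst p.snd}
  zero_mem' := .zero
  add_mem' := fun h h' => h.add h'
  smul_mem' := fun r _ h => h.smul r

theorem H1R.isClosed : IsClosed (H1R : Set (WithLp 2 (L2R × L2R))) := by
  have : (H1R : Set (WithLp 2 (L2R × L2R))) =
      ⋂ (φ : ℝ → ℝ) (hφ : ContDiff ℝ ∞ φ) (hc : HasCompactSupport φ),
        {p | ⟪p.fst, (memLp_deriv_test hφ hc).toLp (deriv φ)⟫ =
          -⟪p.snd, (memLp_test hφ hc).toLp φ⟫} := by
    ext p
    simp only [Set.mem_iInter, Set.mem_ofPred_eq]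
    exact isWeakDeriv_iff_inner
  rw [this]
  refine isClosed_iInter fun φ => isClosed_iInter fun hφ => isClosed_iInter fun hc =>
    isClosed_eq ?_ ?_
  · exact (WithLp.continuous_fst 2 L2R L2R).inner continuous_const
  · exact ((WithLp.continuous_snd 2 L2R L2R).inner continuous_const).neg

theorem prodL2_inner_eq (p q : WithLp 2 (L2R × L2R)) :
    ⟪p, q⟫ = ⟪p.fst, q.fst⟫ + ⟪p.snd, q.snd⟫ := rfl

instance : CompleteSpace H1R := H1R.isClosed.completeSpace_coe

/-- An element of `H¹(ℝ)` orthogonal to all test functions solves `f'' = f`; factoring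
`∂² - 1 = (∂ + 1)(∂ - 1)` shows that it vanishes. Hence test functions are dense in `H¹(ℝ)`. -/
theorem H1R.eq_zero_of_orthogonal_test {p : WithLp 2 (L2R × L2R)} (hp : p ∈ H1R)
    (h : ∀ (φ : ℝ → ℝ) (hφ : ContDiff ℝ ∞ φ) (hc : HasCompactSupport φ),
      ⟪p, WithLp.toLp 2 ((memLp_test hφ hc).toLp φ,
        (memLp_deriv_test hφ hc).toLp (deriv φ))⟫ = 0) : p = 0 := by
  have h1 : IsWeakDeriv p.fst p.snd := hp
  have h2 : IsWeakDeriv p.snd p.fst := isWeakDeriv_iff_inner.2 fun φ hφ hc => by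
    have := h φ hφ hc
    rw [prodL2_inner_eq] at this
    simp only [WithLp.toLp_fst, WithLp.toLp_snd] at this
    linarith
  have h3 := (h2.weakDerivL2.add (h1.weakDerivL2.const_mul (-1))).ae_eq_zero_of_deriv_eq_const_mul
    (s := -1) (by norm_num) (Filter.Eventually.of_forall fun x => by ring)
  have h4 := h1.weakDerivL2.ae_eq_zero_of_deriv_eq_const_mul (s := 1) one_ne_zero (by
    filter_upwards [h3] with x hx
    linarith)
  have e1 : p.fst = 0 := Lp.ext (by
    filter_upwards [h4, Lp.coeFn_zero ℝ 2 volume] with x hx hx0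
    rw [hx, hx0, Pi.zero_apply])
  have e2 : p.snd = 0 := Lp.ext (by
    filter_upwards [h4, h3, Lp.coeFn_zero ℝ 2 volume] with x hx hx' hx0
    rw [hx0, Pi.zero_apply]
    linarith)
  exact WithLp.ofLp_injective 2 (Prod.ext e1 e2)

/-- Integration by parts in `H¹(ℝ)`. The functional `(f, f') ↦ ⟪g', f⟫ + ⟪g, f'⟫` vanishes on test
functions, hence on `H¹(ℝ)`. -/
theorem IsWeakDeriv.inner_add_inner_eq_zero {f f' g g' : L2R} (hf : IsWeakDeriv f f')
    (hg : IsWeakDeriv g g') : ⟪f, g'⟫ + ⟪f', g⟫ = 0 := by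
  set v : WithLp 2 (L2R × L2R) := WithLp.toLp 2 (g', g) with hv
  have hz : H1R.starProjection v = 0 := by
    refine H1R.eq_zero_of_orthogonal_test (H1R.starProjection_apply_mem v) fun φ hφ hc => ?_
    have h1 := H1R.starProjection_inner_eq_zero v (WithLp.toLp 2 ((memLp_test hφ hc).toLp φ,
        (memLp_deriv_test hφ hc).toLp (deriv φ))) (isWeakDeriv_test hφ hc)
    rw [inner_sub_left, sub_eq_zero] at h1
    rw [← h1, prodL2_inner_eq]
    have := isWeakDeriv_iff_inner.1 hg φ hφ hc
    simp only [hv, WithLp.toLp_fst, WithLp.toLp_snd]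
    linarith
  have h1 := H1R.starProjection_inner_eq_zero v (WithLp.toLp 2 (f, f')) hf
  rw [hz, sub_zero, prodL2_inner_eq] at h1
  simp only [hv, WithLp.toLp_fst, WithLp.toLp_snd] at h1
  rw [real_inner_comm, real_inner_comm g]
  exact h1

theorem WeakDerivL2.integral_mul_add_mul_eq_zero {f f' g g' : ℝ → ℝ} (hf : WeakDerivL2 f f')
    (hg : WeakDerivL2 g g') : ∫ x, (f x * g' x + f' x * g x) = 0 := by
  have h := (hf.isWeakDeriv hf.memLp.coeFn_toLp hf.memLp_deriv.coeFn_toLp).inner_add_inner_eq_zero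
    (hg.isWeakDeriv hg.memLp.coeFn_toLp hg.memLp_deriv.coeFn_toLp)
  rw [L2R.inner_toLp, L2R.inner_toLp] at h
  have i1 : Integrable fun x => f x * g' x := hf.memLp.integrable_mul (q := 2) hg.memLp_deriv
  have i2 : Integrable fun x => f' x * g x := hf.memLp_deriv.integrable_mul (q := 2) hg.memLp
  rw [integral_add i1 i2, ← h]
  congr 1
  · refine integral_congr_ae ?_
    filter_upwards [hf.memLp.coeFn_toLp] with x hx
    rw [hx]
  · refine integral_congr_ae ?_
    filter_upwards [hf.memLp_deriv.coeFn_toLp] with x hx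
    rw [hx]

/-- `∫ (a f g)' = 0` for `f, g ∈ H¹(ℝ)` and a smooth multiplier `a`, with the integrability of the
integrand. -/
theorem WeakDerivL2.integral_deriv_mul_mul_eq_zero {f f' g g' a a' : ℝ → ℝ}
    (hf : WeakDerivL2 f f') (hg : WeakDerivL2 g g') (ha : BddSmooth a a') :
    Integrable (fun x => a' x * f x * g x + a x * f' x * g x + a x * f x * g' x) ∧
      ∫ x, (a' x * f x * g x + a x * f' x * g x + a x * f x * g' x) = 0 := by
  have h := hf.smooth_mul ha
  have e : (fun x => a' x * f x * g x + a x * f' x * g x + a x * f x * g' x) =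
      fun x => a x * f x * g' x + (a' x * f x + a x * f' x) * g x := funext fun x => by ring
  rw [e]
  exact ⟨(h.memLp.integrable_mul (q := 2) hg.memLp_deriv).add
    (h.memLp_deriv.integrable_mul (q := 2) hg.memLp), h.integral_mul_add_mul_eq_zero hg⟩

/-! ### Multiplication operators and first order equations -/

theorem mulOp_coeFn (V : ℝ →ᵇ ℝ) (f : L2R) : mulOp V f =ᵐ[volume] fun x => V x * f x :=
  (memLp_bcf_mul V f).coeFn_toLp

theorem norm_mulOp_le (V : ℝ →ᵇ ℝ) (f : L2R) : ‖mulOp V f‖ ≤ ‖V‖ * ‖f‖ := by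
  refine Lp.norm_le_mul_norm_of_ae_le_mul ?_
  filter_upwards [mulOp_coeFn V f] with x hx
  rw [hx, norm_mul]
  exact mul_le_mul_of_nonneg_right (V.norm_coe_le_norm x) (norm_nonneg _)

theorem continuous_mulOp (V : ℝ →ᵇ ℝ) : Continuous (mulOp V) :=
  AddMonoidHomClass.continuous_of_bound (mulOp V) ‖V‖ (norm_mulOp_le V)

theorem inner_mulOp (V : ℝ →ᵇ ℝ) (f g : L2R) : ⟪mulOp V f, g⟫ = ∫ x, V x * f x * g x := by
  rw [L2R.inner_eq_integral]
  refine integral_congr_ae ?_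
  filter_upwards [mulOp_coeFn V f] with x hx
  rw [hx]

theorem inner_mulOp_symm (V : ℝ →ᵇ ℝ) (f g : L2R) : ⟪mulOp V f, g⟫ = ⟪f, mulOp V g⟫ := by
  rw [real_inner_comm (mulOp V g), inner_mulOp, inner_mulOp]
  exact integral_congr_ae (Filter.Eventually.of_forall fun x => by simp only; ring)

/-- A smooth multiplier as a bounded continuous function. -/
noncomputable def BddSmooth.toBCF {a a' : ℝ → ℝ} (h : BddSmooth a a') : ℝ →ᵇ ℝ :=
  BoundedContinuousFunction.ofNormedAddCommGroup a h.contDiff.continuous h.bdd.choose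
    h.bdd.choose_spec

theorem BddSmooth.toBCF_apply {a a' : ℝ → ℝ} (h : BddSmooth a a') (x : ℝ) : h.toBCF x = a x := rfl

/-- The first order operator `∂ - k : H¹(ℝ) → L²(ℝ)`. -/
noncomputable def firstOrderOp (k : ℝ →ᵇ ℝ) : H1R →L[ℝ] L2R where
  toFun p := (p : WithLp 2 (L2R × L2R)).snd - mulOp k (p : WithLp 2 (L2R × L2R)).fst
  map_add' p q := by
    simp only [Submodule.coe_add, WithLp.add_fst, WithLp.add_snd, map_add]
    abel
  map_smul' r p := by
    simp only [Submodule.coe_smul, WithLp.smul_fst, WithLp.smul_snd, map_smul, smul_sub,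
      RingHom.id_apply]
  cont := ((WithLp.continuous_snd 2 L2R L2R).comp continuous_subtype_val).sub
    ((continuous_mulOp k).comp ((WithLp.continuous_fst 2 L2R L2R).comp continuous_subtype_val))

/-- Expanding the square, `‖f' - k f‖² = ‖f'‖² + ∫ (k² + k') f²`. -/
theorem norm_firstOrderOp_sq {k k' : ℝ → ℝ} (hk : BddSmooth k k') (p : H1R) :
    ‖firstOrderOp hk.toBCF p‖ ^ 2 = ‖(p : WithLp 2 (L2R × L2R)).snd‖ ^ 2 +
      ∫ x, (k x ^ 2 + k' x) * (p : WithLp 2 (L2R × L2R)).fst x ^ 2 := by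
  set f := (p : WithLp 2 (L2R × L2R)).fst
  set g := (p : WithLp 2 (L2R × L2R)).snd
  have hfg : IsWeakDeriv f g := p.2
  have hw := hfg.weakDerivL2
  have i1 : Integrable fun x => g x * g x := hw.memLp_deriv.integrable_mul (q := 2) hw.memLp_deriv
  have i2 : Integrable fun x => (k x ^ 2 + k' x) * f x ^ 2 :=
    (((hk.mul hk).integrable_mul_mul hw.memLp hw.memLp).add
      ((hk.memLp_deriv_mul hw.memLp).integrable_mul (q := 2) hw.memLp)).congr
      (Filter.Eventually.of_forall fun x => by simp; ring)
  have i12 : Integrable fun x => g x * g x + (k x ^ 2 + k' x) * f x ^ 2 := i1.add i2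
  obtain ⟨i3, h3⟩ := hw.integral_deriv_mul_mul_eq_zero hw hk
  rw [← real_inner_self_eq_norm_sq, ← real_inner_self_eq_norm_sq, L2R.inner_eq_integral,
    L2R.inner_eq_integral, ← integral_add i1 i2, ← sub_zero (∫ x, (_ + _)), ← h3,
    ← integral_sub i12 i3]
  refine integral_congr_ae ?_
  filter_upwards [Lp.coeFn_sub g (mulOp hk.toBCF f), mulOp_coeFn hk.toBCF f] with x hx hx'
  have : firstOrderOp hk.toBCF p x = g x - k x * f x := by
    have e : firstOrderOp hk.toBCF p = g - mulOp hk.toBCF f := rfl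
    rw [e, hx, Pi.sub_apply, hx', hk.toBCF_apply]
  rw [this]
  ring

/-- Solvability of `u' - k u = w` in `H¹(ℝ)` when `w` is orthogonal to the kernel `E` of the adjoint
`-∂ - k`. The operator `∂ - k` is bounded below because `k² + k' ≥ m > 0`, so its range is closed,
and the orthogonal complement of the range is spanned by `E`. -/
theorem exists_firstOrder_solution {k k' E : ℝ → ℝ} (hk : BddSmooth k k') {m : ℝ} (hm : 0 < m)
    (hkm : ∀ x, m ≤ k x ^ 2 + k' x) (hE : ContDiff ℝ ∞ E) (hE0 : ∀ x, E x ≠ 0)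
    (hE' : ∀ x, HasDerivAt E (-k x * E x) x) (w : L2R) (hw : ∫ x, E x * w x = 0) :
    ∃ u : ℝ → ℝ, WeakDerivL2 u (fun x => k x * u x + w x) := by
  set A := firstOrderOp hk.toBCF with hA
  have hbelow : ∀ p : H1R, min 1 m * ‖p‖ ^ 2 ≤ ‖A p‖ ^ 2 := by
    intro p
    have hfg : IsWeakDeriv (p : WithLp 2 (L2R × L2R)).fst (p : WithLp 2 (L2R × L2R)).snd := p.2
    have hf := hfg.weakDerivL2.memLp
    have h1 : m * ‖(p : WithLp 2 (L2R × L2R)).fst‖ ^ 2 ≤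
        ∫ x, (k x ^ 2 + k' x) * (p : WithLp 2 (L2R × L2R)).fst x ^ 2 := by
      rw [← real_inner_self_eq_norm_sq, L2R.inner_eq_integral, ← integral_const_mul]
      refine integral_mono ((hf.integrable_mul (q := 2) hf).const_mul m) ?_ fun x => ?_
      · exact (((hk.mul hk).integrable_mul_mul hf hf).add
          ((hk.memLp_deriv_mul hf).integrable_mul (q := 2) hf)).congr
          (Filter.Eventually.of_forall fun x => by simp; ring)
      · have := mul_le_mul_of_nonneg_right (hkm x)
          (sq_nonneg ((p : WithLp 2 (L2R × L2R)).fst x))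
        simpa only [Pi.mul_apply, sq] using this
    have h2 : ‖p‖ ^ 2 = ‖(p : WithLp 2 (L2R × L2R)).fst‖ ^ 2 +
        ‖(p : WithLp 2 (L2R × L2R)).snd‖ ^ 2 :=
      WithLp.prod_norm_sq_eq_of_L2 (p : WithLp 2 (L2R × L2R))
    rw [hA, norm_firstOrderOp_sq, h2, mul_add, add_comm]
    have := mul_le_mul_of_nonneg_right (min_le_left 1 m)
      (sq_nonneg ‖(p : WithLp 2 (L2R × L2R)).snd‖)
    have := mul_le_mul_of_nonneg_right (min_le_right 1 m)
      (sq_nonneg ‖(p : WithLp 2 (L2R × L2R)).fst‖)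
    linarith
  have hmin : 0 < min 1 m := lt_min one_pos hm
  have hclosed : IsClosed (Set.range A) := by
    have hanti : AntilipschitzWith (Real.toNNReal (√(min 1 m))⁻¹) A := by
      refine AddMonoidHomClass.antilipschitz_of_bound A fun p => ?_
      rw [Real.coe_toNNReal _ (by positivity), inv_mul_eq_div, le_div_iff₀ (by positivity)]
      refine le_of_sq_le_sq ?_ (norm_nonneg _)
      rw [mul_pow, Real.sq_sqrt hmin.le, mul_comm]
      exact hbelow p
    exact hanti.isClosed_range A.uniformContinuous
  set K := LinearMap.range (A : H1R →ₗ[ℝ] L2R) with hK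
  have hKc : IsClosed (K : Set L2R) := by
    rw [hK, LinearMap.coe_range]
    exact hclosed
  have : CompleteSpace K := hKc.completeSpace_coe
  set v := w - K.starProjection w with hv
  have hvK : ∀ p : H1R, ⟪v, A p⟫ = 0 := fun p =>
    K.starProjection_inner_eq_zero w (A p) ⟨p, rfl⟩
  have hvd : IsWeakDeriv v (-mulOp hk.toBCF v) := isWeakDeriv_iff_inner.2 fun φ hφ hc => by
    have h1 := hvK ⟨WithLp.toLp 2 ((memLp_test hφ hc).toLp φ,
      (memLp_deriv_test hφ hc).toLp (deriv φ)), isWeakDeriv_test hφ hc⟩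
    have h2 : A ⟨WithLp.toLp 2 ((memLp_test hφ hc).toLp φ,
      (memLp_deriv_test hφ hc).toLp (deriv φ)), isWeakDeriv_test hφ hc⟩ =
      (memLp_deriv_test hφ hc).toLp (deriv φ) - mulOp hk.toBCF ((memLp_test hφ hc).toLp φ) := rfl
    rw [h2, inner_sub_right, ← inner_mulOp_symm] at h1
    rw [inner_neg_left]
    linarith
  obtain ⟨c, hc⟩ := hvd.weakDerivL2.ae_eq_const_mul (k := fun x => -k x) hE hE0 hE' (by
    filter_upwards [Lp.coeFn_neg (mulOp hk.toBCF v), mulOp_coeFn hk.toBCF v] with x hx hx'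
    rw [hx, Pi.neg_apply, hx', hk.toBCF_apply]
    ring)
  have hvw : ⟪v, w⟫ = 0 := by
    rw [L2R.inner_eq_integral, integral_congr_ae (g := fun x => c * (E x * w x))
      (by filter_upwards [hc] with x hx; rw [hx]; ring), integral_const_mul, hw, mul_zero]
  obtain ⟨p, hp⟩ : K.starProjection w ∈ K := K.starProjection_apply_mem w
  have hv0 : v = 0 := by
    have h1 := hvK p
    have h2 : A p = w - v := by rw [hv, sub_sub_cancel]; exact hp
    rw [h2, inner_sub_right, hvw, zero_sub, neg_eq_zero] at h1
    exact inner_self_eq_zero.1 h1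
  have hAp : A p = w := by
    rw [hv, sub_eq_zero] at hv0
    exact hp.trans hv0.symm
  have hfg : IsWeakDeriv (p : WithLp 2 (L2R × L2R)).fst (p : WithLp 2 (L2R × L2R)).snd := p.2
  refine ⟨(p : WithLp 2 (L2R × L2R)).fst, hfg.weakDerivL2.congr (Filter.EventuallyEq.refl _ _) ?_⟩
  have e : A p = (p : WithLp 2 (L2R × L2R)).snd - mulOp hk.toBCF (p : WithLp 2 (L2R × L2R)).fst :=
    rfl
  rw [hAp] at e
  filter_upwards [Lp.coeFn_sub (p : WithLp 2 (L2R × L2R)).snd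
    (mulOp hk.toBCF (p : WithLp 2 (L2R × L2R)).fst), mulOp_coeFn hk.toBCF
    (p : WithLp 2 (L2R × L2R)).fst] with x hx hx'
  rw [← e, Pi.sub_apply, hx', hk.toBCF_apply] at hx
  linarith

/-! ### Hyperbolic functions -/

theorem sechB_apply (b x : ℝ) : sechB b x = (Real.cosh (b * x))⁻¹ := by
  rw [← one_div]
  rfl

theorem sechB_pos (b x : ℝ) : 0 < sechB b x := by
  rw [sechB_apply]
  exact inv_pos.2 (Real.cosh_pos _)

theorem sechB_le_one (b x : ℝ) : sechB b x ≤ 1 := by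
  rw [sechB_apply]
  exact inv_le_one_of_one_le₀ (Real.one_le_cosh _)

theorem sechB_sq (b x : ℝ) : sechB b x ^ 2 = 1 - Real.tanh (b * x) ^ 2 := by
  have h := (Real.cosh_pos (b * x)).ne'
  rw [sechB_apply, Real.tanh_eq_sinh_div_cosh]
  field_simp
  rw [Real.cosh_sq]
  ring

theorem hasDerivAt_sechB (b x : ℝ) :
    HasDerivAt (sechB b) (-b * Real.tanh (b * x) * sechB b x) x := by
  have h := (Real.cosh_pos (b * x)).ne'
  have h1 : HasDerivAt (fun x => Real.cosh (b * x)) (Real.sinh (b * x) * b) x := by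
    simpa using ((hasDerivAt_id x).const_mul b).cosh
  have h2 := h1.inv h
  have e : (sechB b : ℝ → ℝ) = (fun x => Real.cosh (b * x))⁻¹ := funext (sechB_apply b)
  rw [e]
  refine h2.congr_deriv ?_
  rw [Pi.inv_apply, Real.tanh_eq_sinh_div_cosh]
  field_simp

theorem hasDerivAt_tanh_mul (b x : ℝ) :
    HasDerivAt (fun x => Real.tanh (b * x)) (b * (1 - Real.tanh (b * x) ^ 2)) x := by
  have h := (Real.cosh_pos (b * x)).ne'
  have h1 : HasDerivAt (fun x => Real.cosh (b * x)) (Real.sinh (b * x) * b) x := by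
    simpa using ((hasDerivAt_id x).const_mul b).cosh
  have h2 : HasDerivAt (fun x => Real.sinh (b * x)) (Real.cosh (b * x) * b) x := by
    simpa using ((hasDerivAt_id x).const_mul b).sinh
  have e : (fun x => Real.tanh (b * x)) = fun x => Real.sinh (b * x) / Real.cosh (b * x) :=
    funext fun x => Real.tanh_eq_sinh_div_cosh _
  rw [e]
  refine (h2.div h1 h).congr_deriv ?_
  rw [Real.tanh_eq_sinh_div_cosh]
  field_simp

theorem contDiff_sechB (b : ℝ) : ContDiff ℝ ∞ (sechB b) := by
  have e : (sechB b : ℝ → ℝ) = fun x => (Real.cosh (b * x))⁻¹ := funext (sechB_apply b)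
  rw [e]
  exact (Real.contDiff_cosh.comp (contDiff_const.mul contDiff_id)).inv
    fun x => (Real.cosh_pos _).ne'

theorem contDiff_tanh_mul (b : ℝ) : ContDiff ℝ ∞ fun x => Real.tanh (b * x) := by
  simp only [Real.tanh_eq_sinh_div_cosh]
  exact (Real.contDiff_sinh.comp (contDiff_const.mul contDiff_id)).div
    (Real.contDiff_cosh.comp (contDiff_const.mul contDiff_id)) fun x => (Real.cosh_pos _).ne'

theorem abs_tanh_le_one (y : ℝ) : |Real.tanh y| ≤ 1 := (Real.abs_tanh_lt_one y).le

theorem abs_sechB_le_one (b x : ℝ) : |sechB b x| ≤ 1 := by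
  rw [abs_of_pos (sechB_pos b x)]
  exact sechB_le_one b x

theorem bddSmooth_sechB (b : ℝ) :
    BddSmooth (sechB b) fun x => -b * Real.tanh (b * x) * sechB b x :=
  ⟨contDiff_sechB b, hasDerivAt_sechB b, ⟨1, abs_sechB_le_one b⟩, ⟨|-b| * 1 * 1, fun x =>
    abs_mul_le_of_le (abs_mul_le_of_le le_rfl (abs_tanh_le_one _)) (abs_sechB_le_one b x)⟩⟩

theorem bddSmooth_tanh (b : ℝ) :
    BddSmooth (fun x => Real.tanh (b * x)) fun x => b * (1 - Real.tanh (b * x) ^ 2) := by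
  refine ⟨contDiff_tanh_mul b, hasDerivAt_tanh_mul b, ⟨1, fun x => abs_tanh_le_one _⟩,
    ⟨|b| * (1 * 1), fun x => ?_⟩⟩
  rw [← sechB_sq, sq]
  exact abs_mul_le_of_le le_rfl (abs_mul_le_of_le (abs_sechB_le_one b x) (abs_sechB_le_one b x))

/-- `sech` is square integrable, since `cosh² y = 1 + sinh² y ≥ 1 + y²`. -/
theorem memLp_sechB {b : ℝ} (hb : b ≠ 0) : MemLp (sechB b) 2 volume := by
  rw [memLp_two_iff_integrable_sq (sechB b).continuous.aestronglyMeasurable]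
  refine (integrable_inv_one_add_sq.comp_mul_left' hb).mono'
    ((sechB b).continuous.pow 2).aestronglyMeasurable (Filter.Eventually.of_forall fun x => ?_)
  rw [Real.norm_of_nonneg (sq_nonneg _), sechB_apply, inv_pow, Real.cosh_sq]
  refine inv_anti₀ (by positivity) ?_
  have h : |b * x| ≤ |Real.sinh (b * x)| := by
    rw [Real.abs_sinh]
    exact Real.self_le_sinh_iff.2 (abs_nonneg _)
  have := sq_le_sq.2 h
  linarith

/-- Products of `sech` with a multiplier lie in `H¹(ℝ)`. -/
theorem BddSmooth.weakDerivL2_mul_sechB {a a' : ℝ → ℝ} (h : BddSmooth a a') {b : ℝ}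
    (hb : b ≠ 0) : WeakDerivL2 (fun x => a x * sechB b x)
      (fun x => a' x * sechB b x + a x * (-b * Real.tanh (b * x) * sechB b x)) := by
  have h0 : WeakDerivL2 (sechB b) fun x => -b * Real.tanh (b * x) * sechB b x :=
    .of_hasDerivAt (hasDerivAt_sechB b) (memLp_sechB hb)
      (((BddSmooth.const (-b)).mul (bddSmooth_tanh b)).memLp_mul (memLp_sechB hb))
  exact h0.smooth_mul h

/-! ### Quadratic energies as sums of squares -/

theorem integral_eq_integral_of_sub_total {p q g : ℝ → ℝ} (hq : Integrable q)
    (hg : Integrable g) (h0 : ∫ x, g x = 0) (h : ∀ᵐ x, p x = q x + g x) :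
    ∫ x, p x = ∫ x, q x := by
  rw [integral_congr_ae h, integral_add hq hg, h0, add_zero]

theorem integral_add_eq_zero {f g : ℝ → ℝ} (hf : Integrable f ∧ ∫ x, f x = 0)
    (hg : Integrable g ∧ ∫ x, g x = 0) :
    Integrable (fun x => f x + g x) ∧ ∫ x, (f x + g x) = 0 :=
  ⟨hf.1.add hg.1, by rw [integral_add hf.1 hg.1, hf.2, hg.2, add_zero]⟩

theorem WeakDerivL2.integrable_scalarSquare {b : ℝ} {z z' : ℝ → ℝ} (hz : WeakDerivL2 z z') :
    Integrable fun x => (z' x + b * Real.tanh (b * x) * z x) ^ 2 :=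
  (hz.memLp_deriv.add (((BddSmooth.const b).mul (bddSmooth_tanh b)).memLp_mul
    hz.memLp)).integrable_sq

/-- The weak solutions of `z' + b tanh(b x) z = 0` are the multiples of `sech`. -/
theorem WeakDerivL2.ae_eq_const_mul_sechB {b : ℝ} {z z' : ℝ → ℝ} (hz : WeakDerivL2 z z')
    (h : ∀ᵐ x, z' x + b * Real.tanh (b * x) * z x = 0) : ∃ β : ℝ, ∀ᵐ x, z x = β * sechB b x :=
  hz.ae_eq_const_mul (k := fun x => -b * Real.tanh (b * x)) (contDiff_sechB b)
    (fun x => (sechB_pos b x).ne') (hasDerivAt_sechB b) (by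
      filter_upwards [h] with x hx
      linarith)

theorem hasDerivAt_sechB_sq (b x : ℝ) : HasDerivAt (fun x => sechB b x ^ 2)
    (-(2 * b * Real.tanh (b * x)) * sechB b x ^ 2) x := by
  have := (hasDerivAt_sechB b x).pow 2
  refine this.congr_deriv ?_
  push_cast
  ring

/-- The weak solutions of `u' + 2 b tanh(b x) u = 0` are the multiples of `sech²`. -/
theorem WeakDerivL2.ae_eq_const_mul_sechB_sq {b : ℝ} {u u' : ℝ → ℝ} (hu : WeakDerivL2 u u')
    (h : ∀ᵐ x, u' x + 2 * b * Real.tanh (b * x) * u x = 0) :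
    ∃ a : ℝ, ∀ᵐ x, u x = a * sechB b x ^ 2 :=
  hu.ae_eq_const_mul (k := fun x => -(2 * b * Real.tanh (b * x))) (contDiff_sechB b |>.pow 2)
    (fun x => (pow_pos (sechB_pos b x) 2).ne') (hasDerivAt_sechB_sq b) (by
      filter_upwards [h] with x hx
      linarith)

/-- The energy density of `-∂² + b² - 2 b² sech²(b x)`. -/
noncomputable def scalarDensity (b : ℝ) (z z' : ℝ → ℝ) (x : ℝ) : ℝ :=
  z' x ^ 2 + b ^ 2 * z x ^ 2 - 2 * b ^ 2 * sechB b x ^ 2 * z x ^ 2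

/-- The operator `-∂² + b² - 2 b² sech²(b x)` factors through `∂ + b tanh(b x)`. -/
theorem integral_scalarDensity {b : ℝ} {z z' : ℝ → ℝ} (hz : WeakDerivL2 z z') :
    ∫ x, scalarDensity b z z' x = ∫ x, (z' x + b * Real.tanh (b * x) * z x) ^ 2 := by
  obtain ⟨i, h⟩ := hz.integral_deriv_mul_mul_eq_zero hz (bddSmooth_tanh b)
  refine integral_eq_integral_of_sub_total hz.integrable_scalarSquare (i.const_mul (-b))
    (by rw [integral_const_mul, h, mul_zero]) (Filter.Eventually.of_forall fun x => ?_)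
  simp only [scalarDensity]
  linear_combination (-2 * b ^ 2 * z x ^ 2) * sechB_sq b x

theorem integral_scalarDensity_nonneg {b : ℝ} {z z' : ℝ → ℝ} (hz : WeakDerivL2 z z') :
    0 ≤ ∫ x, scalarDensity b z z' x := by
  rw [integral_scalarDensity hz]
  exact integral_nonneg fun x => sq_nonneg _

theorem ae_eq_of_integral_scalarDensity_eq_zero {b : ℝ} {z z' : ℝ → ℝ} (hz : WeakDerivL2 z z')
    (h : ∫ x, scalarDensity b z z' x = 0) : ∃ β : ℝ, ∀ᵐ x, z x = β * sechB b x := by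
  rw [integral_scalarDensity hz, integral_eq_zero_iff_of_nonneg (fun x => sq_nonneg _)
    hz.integrable_scalarSquare] at h
  refine hz.ae_eq_const_mul_sechB ?_
  filter_upwards [h] with x hx
  exact pow_eq_zero_iff two_ne_zero |>.1 hx

/-- The energy density of the coupled block
`(-∂² + c - 12 b² sech²) ⊕ 12 (-∂² + b² - 2 b² sech²)` with off-diagonal entries `-12 ρ sech`. -/
noncomputable def blockDensity (b c ρ : ℝ) (w w' z z' : ℝ → ℝ) (x : ℝ) : ℝ :=
  w' x ^ 2 + c * w x ^ 2 - 12 * b ^ 2 * sechB b x ^ 2 * w x ^ 2 -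
    24 * ρ * sechB b x * w x * z x + 12 * scalarDensity b z z' x

/-- The sum of squares behind the constrained nonnegativity. Write `w = u' - 2 b tanh(b x) u` and
`r = u' + 2 b tanh(b x) u`. When `3 ρ² = b² (c - 4 b²)`, the energy of `(w, z)` equals
`∫ (r'² + c r² + 12 (z' + b tanh(b x) z + ρ sech(b x) u)²)`, the densities differing by the
derivative of a quadratic expression in `(w, u, z)`. -/
theorem integral_blockDensity {b c ρ : ℝ} (hρ : 3 * ρ ^ 2 = b ^ 2 * (c - 4 * b ^ 2))
    {w w' z z' u : ℝ → ℝ} (hw : WeakDerivL2 w w') (hz : WeakDerivL2 z z')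
    (hu : WeakDerivL2 u fun x => 2 * b * Real.tanh (b * x) * u x + w x) :
    ∃ r' : ℝ → ℝ, WeakDerivL2 (fun x => w x + 4 * b * Real.tanh (b * x) * u x) r' ∧
      Integrable (fun x => r' x ^ 2 + c * (w x + 4 * b * Real.tanh (b * x) * u x) ^ 2 +
        12 * (z' x + b * Real.tanh (b * x) * z x + ρ * sechB b x * u x) ^ 2) ∧
      ∫ x, blockDensity b c ρ w w' z z' x =
        ∫ x, (r' x ^ 2 + c * (w x + 4 * b * Real.tanh (b * x) * u x) ^ 2 +
          12 * (z' x + b * Real.tanh (b * x) * z x + ρ * sechB b x * u x) ^ 2) := by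
  have hT := bddSmooth_tanh b
  have hS := bddSmooth_sechB b
  have hr := hw.add (hu.smooth_mul ((BddSmooth.const (4 * b)).mul hT))
  have hr2 := hr.memLp_deriv.integrable_sq
  have hr1 := hr.memLp.integrable_sq
  have hy := ((hz.memLp_deriv.add (((BddSmooth.const b).mul hT).memLp_mul hz.memLp)).add
    (((BddSmooth.const ρ).mul hS).memLp_mul hu.memLp)).integrable_sq
  refine ⟨_, hr, (hr2.add (hr1.const_mul c)).add (hy.const_mul 12), ?_⟩
  -- The two densities differ by the derivative of
  -- `-4 b T w² - 8 b² (1 + T²) w u - (16 b³ T³ + 4 c b T) u² - 12 b T z² - 24 ρ S u z`.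
  have h1 := hw.integral_deriv_mul_mul_eq_zero hw ((BddSmooth.const (-4 * b)).mul hT)
  have h2 := hw.integral_deriv_mul_mul_eq_zero hu
    ((BddSmooth.const (-8 * b ^ 2)).add ((BddSmooth.const (-8 * b ^ 2)).mul (hT.mul hT)))
  have h3 := hu.integral_deriv_mul_mul_eq_zero hu
    (((BddSmooth.const (-16 * b ^ 3)).mul (hT.mul (hT.mul hT))).add
      ((BddSmooth.const (-4 * c * b)).mul hT))
  have h4 := hz.integral_deriv_mul_mul_eq_zero hz ((BddSmooth.const (-12 * b)).mul hT)
  have h5 := hu.integral_deriv_mul_mul_eq_zero hz ((BddSmooth.const (-24 * ρ)).mul hS)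
  obtain ⟨hi, h0⟩ := integral_add_eq_zero (integral_add_eq_zero (integral_add_eq_zero
    (integral_add_eq_zero h1 h2) h3) h4) h5
  refine integral_eq_integral_of_sub_total ((hr2.add (hr1.const_mul c)).add (hy.const_mul 12))
    hi h0 (Filter.Eventually.of_forall fun x => ?_)
  simp only [blockDensity, scalarDensity]
  linear_combination (-12 * b ^ 2 * w x ^ 2 - 24 * b ^ 2 * z x ^ 2 - 12 * ρ ^ 2 * u x ^ 2) *
    sechB_sq b x - 4 * (1 - Real.tanh (b * x) ^ 2) * u x ^ 2 * hρ

/-- On the constraint hyperplane, `w` has the form `u' - 2 b tanh(b x) u` with `u ∈ H¹(ℝ)`. -/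
theorem exists_firstOrder_potential {b : ℝ} (hb : 0 < b) {w w' : ℝ → ℝ} (hw : WeakDerivL2 w w')
    (h0 : ∫ x, sechB b x ^ 2 * w x = 0) :
    ∃ u : ℝ → ℝ, WeakDerivL2 u fun x => 2 * b * Real.tanh (b * x) * u x + w x := by
  have hk := (BddSmooth.const (2 * b)).mul (bddSmooth_tanh b)
  obtain ⟨u, hu⟩ := exists_firstOrder_solution hk (m := 2 * b ^ 2) (E := fun x => sechB b x ^ 2)
    (by positivity) (fun x => by
      have := mul_nonneg (sq_nonneg b) (sq_nonneg (Real.tanh (b * x)))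
      nlinarith) ((contDiff_sechB b).pow 2)
    (fun x => (pow_pos (sechB_pos b x) 2).ne') (hasDerivAt_sechB_sq b) (hw.memLp.toLp w) (by
      rw [← h0]
      refine integral_congr_ae ?_
      filter_upwards [hw.memLp.coeFn_toLp] with x hx
      rw [hx])
  refine ⟨u, hu.congr (Filter.EventuallyEq.refl _ _) ?_⟩
  filter_upwards [hw.memLp.coeFn_toLp] with x hx
  rw [hx]

theorem integral_blockDensity_nonneg {b c ρ : ℝ} (hb : 0 < b) (hc : 0 < c)
    (hρ : 3 * ρ ^ 2 = b ^ 2 * (c - 4 * b ^ 2)) {w w' z z' : ℝ → ℝ} (hw : WeakDerivL2 w w')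
    (hz : WeakDerivL2 z z') (h0 : ∫ x, sechB b x ^ 2 * w x = 0) :
    0 ≤ ∫ x, blockDensity b c ρ w w' z z' x := by
  obtain ⟨u, hu⟩ := exists_firstOrder_potential hb hw h0
  obtain ⟨r', -, -, h⟩ := integral_blockDensity hρ hw hz hu
  rw [h]
  exact integral_nonneg fun x => by positivity

/-- On the constraint, the energy vanishes only on the span of `(4 b² sech² tanh, ρ sech tanh)` and
`(0, sech)`: the squares force `u` to be a multiple of `sech²` and determine `z` up to a multiple
of `sech`. -/
theorem ae_eq_of_integral_blockDensity_eq_zero {b c ρ : ℝ} (hb : 0 < b) (hc : 0 < c)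
    (hρ : 3 * ρ ^ 2 = b ^ 2 * (c - 4 * b ^ 2)) {w w' z z' : ℝ → ℝ} (hw : WeakDerivL2 w w')
    (hz : WeakDerivL2 z z') (h0 : ∫ x, sechB b x ^ 2 * w x = 0)
    (hq : ∫ x, blockDensity b c ρ w w' z z' x = 0) :
    ∃ a β : ℝ, (∀ᵐ x, w x = a * (4 * b ^ 2 * Real.tanh (b * x) * sechB b x ^ 2)) ∧
      ∀ᵐ x, z x = a * (ρ * Real.tanh (b * x) * sechB b x) + β * sechB b x := by
  obtain ⟨u, hu⟩ := exists_firstOrder_potential hb hw h0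
  obtain ⟨r', -, i, h⟩ := integral_blockDensity hρ hw hz hu
  rw [h, integral_eq_zero_iff_of_nonneg (fun x => by positivity) i] at hq
  have hr : ∀ᵐ x, w x + 4 * b * Real.tanh (b * x) * u x = 0 := by
    filter_upwards [hq] with x hx
    simp only [Pi.zero_apply] at hx
    have h1 : c * (w x + 4 * b * Real.tanh (b * x) * u x) ^ 2 = 0 := by
      have := mul_nonneg hc.le (sq_nonneg (w x + 4 * b * Real.tanh (b * x) * u x))
      linarith [sq_nonneg (r' x),
        sq_nonneg (z' x + b * Real.tanh (b * x) * z x + ρ * sechB b x * u x)]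
    exact pow_eq_zero_iff two_ne_zero |>.1 ((mul_eq_zero.1 h1).resolve_left hc.ne')
  have hy : ∀ᵐ x, z' x + b * Real.tanh (b * x) * z x + ρ * sechB b x * u x = 0 := by
    filter_upwards [hq] with x hx
    simp only [Pi.zero_apply] at hx
    have := mul_nonneg hc.le (sq_nonneg (w x + 4 * b * Real.tanh (b * x) * u x))
    refine pow_eq_zero_iff two_ne_zero |>.1 (le_antisymm ?_ (sq_nonneg _))
    linarith [sq_nonneg (r' x)]
  obtain ⟨a, ha⟩ := hu.ae_eq_const_mul_sechB_sq (b := b) (by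
    filter_upwards [hr] with x hx
    linarith)
  -- `(sech tanh)' + b tanh (sech tanh) = b sech³`, so this correction makes `z` solve the
  -- homogeneous equation.
  obtain ⟨β, hβ⟩ := (hz.add (((bddSmooth_tanh b).weakDerivL2_mul_sechB hb.ne').const_mul
    (ρ * a / b))).ae_eq_const_mul_sechB (b := b) (by
      filter_upwards [hy, ha] with x hx hx'
      rw [hx'] at hx
      have hb0 := hb.ne'
      have e : ρ * a / b * b = ρ * a := by field_simp
      linear_combination hx - ρ * a * sechB b x * sechB_sq b x +
        (1 - Real.tanh (b * x) ^ 2) * sechB b x * e)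
  refine ⟨-a / b, β, ?_, ?_⟩
  · filter_upwards [hr, ha] with x hx hx'
    rw [hx'] at hx
    have e : a / b * b = a := by have := hb.ne'; field_simp
    linear_combination hx + 4 * b * Real.tanh (b * x) * sechB b x ^ 2 * e
  · filter_upwards [hβ] with x hx
    linear_combination hx

theorem WeakDerivL2.deriv_ae_eq {f g f' g' : ℝ → ℝ} (h : WeakDerivL2 f g)
    (h' : WeakDerivL2 f' g') (e : f =ᵐ[volume] f') : g =ᵐ[volume] g' := by
  have h1 := (h.congr e (Filter.EventuallyEq.refl _ _)).isWeakDeriv h'.memLp.coeFn_toLp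
    h.memLp_deriv.coeFn_toLp
  have h2 := h'.isWeakDeriv h'.memLp.coeFn_toLp h'.memLp_deriv.coeFn_toLp
  have h3 := h1.unique h2
  exact h.memLp_deriv.coeFn_toLp.symm.trans (h3 ▸ h'.memLp_deriv.coeFn_toLp)

theorem integral_scalarDensity_eq_zero {b : ℝ} (hb : b ≠ 0) {z z' : ℝ → ℝ}
    (hz : WeakDerivL2 z z') {β : ℝ} (h : ∀ᵐ x, z x = β * sechB b x) :
    ∫ x, scalarDensity b z z' x = 0 := by
  rw [integral_scalarDensity hz]
  refine integral_eq_zero_of_ae ?_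
  filter_upwards [h, hz.deriv_ae_eq ((BddSmooth.const β).weakDerivL2_mul_sechB hb) h] with x h1 h2
  rw [h1, h2, Pi.zero_apply]
  ring

theorem weakDerivL2_sechB_sq {b : ℝ} (hb : b ≠ 0) : WeakDerivL2 (fun x => sechB b x ^ 2)
    fun x => -(2 * b * Real.tanh (b * x)) * sechB b x ^ 2 := by
  have h := (bddSmooth_sechB b).weakDerivL2_mul_sechB hb
  refine h.congr (Filter.Eventually.of_forall fun x => ?_) (Filter.Eventually.of_forall fun x => ?_)
  · simp only; ring
  · simp only; ring

/-- The energy vanishes on the translation mode. -/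
theorem integral_blockDensity_eq_zero {b c ρ : ℝ} (hb : 0 < b)
    (hρ : 3 * ρ ^ 2 = b ^ 2 * (c - 4 * b ^ 2)) {w w' z z' : ℝ → ℝ} (hw : WeakDerivL2 w w')
    (hz : WeakDerivL2 z z') {a : ℝ}
    (ew : ∀ᵐ x, w x = a * (4 * b ^ 2 * Real.tanh (b * x) * sechB b x ^ 2))
    (ez : ∀ᵐ x, z x = a * (ρ * Real.tanh (b * x) * sechB b x)) :
    ∫ x, blockDensity b c ρ w w' z z' x = 0 := by
  have hu : WeakDerivL2 (fun x => -(a * b) * sechB b x ^ 2)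
      fun x => 2 * b * Real.tanh (b * x) * (-(a * b) * sechB b x ^ 2) + w x := by
    refine ((weakDerivL2_sechB_sq hb.ne').const_mul (-(a * b))).congr
      (Filter.EventuallyEq.refl _ _) ?_
    filter_upwards [ew] with x hx
    rw [hx]
    ring
  obtain ⟨r', hr, -, h⟩ := integral_blockDensity hρ hw hz hu
  have hr0 : ∀ᵐ x, w x + 4 * b * Real.tanh (b * x) * (-(a * b) * sechB b x ^ 2) =
      0 * sechB b x := by
    filter_upwards [ew] with x hx
    rw [hx]
    ring
  have hr' := hr.deriv_ae_eq ((BddSmooth.const 0).weakDerivL2_mul_sechB hb.ne') hr0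
  have ez' : ∀ᵐ x, z x = a * ρ * Real.tanh (b * x) * sechB b x := by
    filter_upwards [ez] with x hx
    rw [hx]
    ring
  have hz' := hz.deriv_ae_eq
    (((BddSmooth.const (a * ρ)).mul (bddSmooth_tanh b)).weakDerivL2_mul_sechB hb.ne') ez'
  rw [h]
  refine integral_eq_zero_of_ae ?_
  filter_upwards [hr0, hr', ez', hz'] with x h1 h2 h3 h4
  have h5 : z' x + b * Real.tanh (b * x) * z x +
      ρ * sechB b x * (-(a * b) * sechB b x ^ 2) = 0 := by
    rw [h3, h4]
    linear_combination (-a * ρ * b * sechB b x) * sechB_sq b x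
  rw [h1, h2, h5, Pi.zero_apply]
  ring

theorem integral_sechB_sq_pos {b : ℝ} (hb : b ≠ 0) : 0 < ∫ x, sechB b x ^ 2 := by
  rw [integral_pos_iff_support_of_nonneg (fun x => by positivity) (memLp_sechB hb).integrable_sq]
  have : Function.support (fun x => sechB b x ^ 2) = Set.univ :=
    Set.eq_univ_of_forall fun x => (pow_pos (sechB_pos b x) 2).ne'
  rw [this]
  simp

/-- `sech² tanh` is a total derivative. -/
theorem integral_tanh_mul_sechB_sq {b : ℝ} (hb : b ≠ 0) :
    ∫ x, Real.tanh (b * x) * sechB b x ^ 2 = 0 := by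
  have h0 := (BddSmooth.const 1).weakDerivL2_mul_sechB hb
  have h := h0.integral_mul_add_mul_eq_zero h0
  have e : ∀ x, 1 * sechB b x * (0 * sechB b x + 1 * (-b * Real.tanh (b * x) * sechB b x)) +
      (0 * sechB b x + 1 * (-b * Real.tanh (b * x) * sechB b x)) * (1 * sechB b x) =
      (-2 * b) * (Real.tanh (b * x) * sechB b x ^ 2) := fun x => by ring
  simp only [e] at h
  rw [integral_const_mul] at h
  exact (mul_eq_zero.1 h).resolve_left (mul_ne_zero (by norm_num) hb)

/-- The energy is negative in the direction `(sech², ρ / (4 b²) sech)`, which is proportional to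
`(U, A / 2)` at the profile `(U, A)`. -/
theorem integral_blockDensity_neg {b c ρ : ℝ} (hb : 0 < b) (hc : 4 * b ^ 2 < c)
    (hρ : 3 * ρ ^ 2 = b ^ 2 * (c - 4 * b ^ 2)) :
    ∫ x, blockDensity b c ρ (fun x => sechB b x ^ 2)
      (fun x => -(2 * b * Real.tanh (b * x)) * sechB b x ^ 2)
      (fun x => ρ / (4 * b ^ 2) * sechB b x)
      (fun x => 0 * sechB b x + ρ / (4 * b ^ 2) * (-b * Real.tanh (b * x) * sechB b x)) x < 0 := by
  have hb0 := hb.ne'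
  have hw := weakDerivL2_sechB_sq hb0
  have hz := (BddSmooth.const (ρ / (4 * b ^ 2))).weakDerivL2_mul_sechB hb0
  -- Up to the derivative of `-2 b T w² - 12 b T z²`, the density is
  -- `-(c - 4 b²) S⁴ - 6 b² S⁶`.
  obtain ⟨i1, h1⟩ := integral_add_eq_zero (hw.integral_deriv_mul_mul_eq_zero hw
    ((BddSmooth.const (-2 * b)).mul (bddSmooth_tanh b)))
    (hz.integral_deriv_mul_mul_eq_zero hz ((BddSmooth.const (-12 * b)).mul (bddSmooth_tanh b)))
  have i2 : Integrable fun x => sechB b x ^ 2 * sechB b x ^ 2 :=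
    hw.memLp.integrable_mul (q := 2) hw.memLp
  have i3 : Integrable fun x => sechB b x * sechB b x * (sechB b x ^ 2) * (sechB b x ^ 2) :=
    ((bddSmooth_sechB b).mul (bddSmooth_sechB b)).integrable_mul_mul hw.memLp hw.memLp
  have hi : Integrable fun x => ((c - 4 * b ^ 2) * (sechB b x ^ 2 * sechB b x ^ 2) +
      6 * b ^ 2 * (sechB b x * sechB b x * (sechB b x ^ 2) * (sechB b x ^ 2))) :=
    (i2.const_mul _).add (i3.const_mul _)
  rw [integral_eq_integral_of_sub_total hi.neg i1 h1 (Filter.Eventually.of_forall fun x => ?_)]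
  · rw [integral_neg', neg_lt_zero, integral_pos_iff_support_of_nonneg (fun x => ?_) hi]
    · have : Function.support (fun x => (c - 4 * b ^ 2) * (sechB b x ^ 2 * sechB b x ^ 2) +
          6 * b ^ 2 * (sechB b x * sechB b x * (sechB b x ^ 2) * (sechB b x ^ 2))) = Set.univ := by
        refine Set.eq_univ_of_forall fun x => ?_
        have := sechB_pos b x
        have h4 : 0 < c - 4 * b ^ 2 := sub_pos.2 hc
        rw [Function.mem_support]
        positivity
      rw [this]
      simp
    · have h4 : 0 < c - 4 * b ^ 2 := sub_pos.2 hc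
      have := sechB_pos b x
      positivity
  · simp only [blockDensity, scalarDensity, Pi.neg_apply]
    set S := sechB b x
    set T := Real.tanh (b * x)
    have hS : S ^ 2 = 1 - T ^ 2 := sechB_sq b x
    have hT : T ^ 2 = 1 - S ^ 2 := by rw [hS]; ring
    have e1 : ρ / (4 * b ^ 2) * ρ * 12 = c - 4 * b ^ 2 := by
      have : ρ / (4 * b ^ 2) * ρ * 12 = 3 * ρ ^ 2 / b ^ 2 := by field_simp; ring
      rw [this, hρ]
      field_simp
    linear_combination (-2 * S ^ 4) * e1 -
      (6 * b ^ 2 * S ^ 4 + 24 * b ^ 2 * (ρ / (4 * b ^ 2)) ^ 2 * S ^ 2) * hT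

/-! ### Negative eigenvalues of forms that are nonnegative on a hyperplane -/

section Variational

variable {X : Type*} [NormedAddCommGroup X] [NormedSpace ℝ X]

theorem bilin_apply_add_smul (N : X →ₗ[ℝ] X →ₗ[ℝ] ℝ) (hN : ∀ x y, N x y = N y x)
    (x y : X) (s : ℝ) :
    N (x + s • y) (x + s • y) = N x x + 2 * s * N x y + s ^ 2 * N y y := by
  simp only [map_add, map_smul, LinearMap.add_apply, LinearMap.smul_apply, smul_eq_mul, hN y x]
  ring

theorem bilin_apply_smul_smul (N : X →ₗ[ℝ] X →ₗ[ℝ] ℝ) (x : X) (s : ℝ) :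
    N (s • x) (s • x) = s ^ 2 * N x x := by
  simp only [map_smul, LinearMap.smul_apply, smul_eq_mul]
  ring

/-- A null vector of a nonnegative form lies in its kernel. -/
theorem bilin_eq_zero_of_self_eq_zero (N : X →ₗ[ℝ] X →ₗ[ℝ] ℝ) (hN : ∀ x y, N x y = N y x)
    (h0 : ∀ x, 0 ≤ N x x) {x : X} (hx : N x x = 0) (y : X) : N x y = 0 := by
  by_contra hne
  have hy := h0 y
  have h1 := h0 (x + (-(N x y) / (N y y + 1)) • y)
  rw [bilin_apply_add_smul N hN, hx] at h1
  have h2 : 0 + 2 * (-(N x y) / (N y y + 1)) * N x y + (-(N x y) / (N y y + 1)) ^ 2 * N y y =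
      -((N x y) ^ 2 * (N y y + 2) / (N y y + 1) ^ 2) := by
    field_simp
    ring
  rw [h2] at h1
  have : 0 < (N x y) ^ 2 * (N y y + 2) / (N y y + 1) ^ 2 := by positivity
  linarith

theorem bilin_sub_self_le (N : X →ₗ[ℝ] X →ₗ[ℝ] ℝ) (hN : ∀ x y, N x y = N y x)
    (h0 : ∀ x, 0 ≤ N x x) (x y : X) : N (x - y) (x - y) ≤ 2 * N x x + 2 * N y y := by
  have h1 := h0 (x + (1 : ℝ) • y)
  have h2 := bilin_apply_add_smul N hN x y (-1)
  rw [bilin_apply_add_smul N hN] at h1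
  rw [neg_one_smul, ← sub_eq_add_neg] at h2
  linarith

open Filter Topology in
/-- A sequence along which a nonnegative form tends to zero has a convergent subsequence, provided
the sequence is bounded and the form is coercive on a closed hyperplane: after extraction the
component transversal to the hyperplane converges, and the parallelogram inequality makes the other
one Cauchy. -/
theorem exists_tendsto_subseq_of_coercive_on_ker [CompleteSpace X] (N : X →ₗ[ℝ] X →ₗ[ℝ] ℝ)
    (hN : ∀ x y, N x y = N y x) (h0 : ∀ x, 0 ≤ N x x) (l : X →L[ℝ] ℝ) {e : X} (he : l e = 1)
    {ε : ℝ} (hε : 0 < ε) (hco : ∀ x, l x = 0 → ε * ‖x‖ ^ 2 ≤ N x x) {x : ℕ → X} {R : ℝ}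
    (hR : ∀ n, ‖x n‖ ≤ R) (hx : Tendsto (fun n => N (x n) (x n)) atTop (𝓝 0)) :
    ∃ (φ : ℕ → ℕ) (a : X), StrictMono φ ∧ Tendsto (x ∘ φ) atTop (𝓝 a) := by
  have hbd : ∀ n, l (x n) ∈ Metric.closedBall (0 : ℝ) (‖l‖ * R) := fun n => by
    rw [mem_closedBall_zero_iff]
    exact (l.le_opNorm _).trans (mul_le_mul_of_nonneg_left (hR n) (norm_nonneg _))
  obtain ⟨t, -, φ, hφ, ht⟩ := tendsto_subseq_of_bounded Metric.isBounded_closedBall hbd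
  set y : ℕ → X := x ∘ φ with hy
  set v : ℕ → X := fun n => y n - l (y n) • e with hv
  have hNy : Tendsto (fun n => N (y n) (y n)) atTop (𝓝 0) := hx.comp hφ.tendsto_atTop
  have hty : Tendsto (fun n => l (y n)) atTop (𝓝 t) := ht
  have hest : ∀ n m, ε * ‖v n - v m‖ ^ 2 ≤
      4 * N (y n) (y n) + 4 * N (y m) (y m) + 2 * (l (y n) - l (y m)) ^ 2 * N e e := by
    intro n m
    have hl : l (v n - v m) = 0 := by simp [hv, he]
    refine (hco _ hl).trans ?_
    have e1 : v n - v m = (y n - y m) - (l (y n) - l (y m)) • e := by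
      simp only [hv, sub_smul]
      abel
    rw [e1]
    have h1 := bilin_sub_self_le N hN h0 (y n - y m) ((l (y n) - l (y m)) • e)
    have h2 := bilin_sub_self_le N hN h0 (y n) (y m)
    rw [bilin_apply_smul_smul] at h1
    linarith
  have hcau : CauchySeq v := by
    rw [Metric.cauchySeq_iff']
    intro δ hδ
    have hlim : Tendsto (fun p : ℕ × ℕ => 4 * N (y p.1) (y p.1) + 4 * N (y p.2) (y p.2) +
        2 * (l (y p.1) - l (y p.2)) ^ 2 * N e e) (atTop ×ˢ atTop) (𝓝 0) := by
      have a1 := hNy.comp (tendsto_fst (f := atTop) (g := (atTop : Filter ℕ)))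
      have a2 := hNy.comp (tendsto_snd (f := (atTop : Filter ℕ)) (g := atTop))
      have a3 := hty.comp (tendsto_fst (f := atTop) (g := (atTop : Filter ℕ)))
      have a4 := hty.comp (tendsto_snd (f := (atTop : Filter ℕ)) (g := atTop))
      have := ((a1.const_mul 4).add (a2.const_mul 4)).add
        ((((a3.sub a4).pow 2).const_mul 2).mul_const (N e e))
      simpa using this
    have hpos : 0 < ε * δ ^ 2 := by positivity
    have hev := hlim.eventually (gt_mem_nhds hpos)
    rw [prod_atTop_atTop_eq, eventually_atTop] at hev
    obtain ⟨⟨n₁, n₂⟩, h⟩ := hev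
    refine ⟨max n₁ n₂, fun n hn => ?_⟩
    have h1 := h (n, max n₁ n₂) ⟨(le_max_left _ _).trans hn, le_max_right _ _⟩
    have h2 := (hest n (max n₁ n₂)).trans_lt h1
    rw [dist_eq_norm]
    exact lt_of_pow_lt_pow_left₀ 2 hδ.le (lt_of_mul_lt_mul_left h2 hε.le)
  obtain ⟨a, ha⟩ := cauchySeq_tendsto_of_complete hcau
  refine ⟨φ, a + t • e, hφ, ?_⟩
  have : x ∘ φ = fun n => v n + l (y n) • e := funext fun n => by simp [hv, hy]
  rw [this]
  exact ha.add (hty.smul_const e)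

open Filter Topology in
/-- Existence of a negative eigenvalue in the weak sense. Suppose the form `B` satisfies a Gårding
inequality relative to `M`, is nonnegative on a closed hyperplane, and takes a negative value. Then
the infimum `μ < 0` of the Rayleigh quotient `B / M` is attained: `B - μ M` is nonnegative, and
coercive on the hyperplane because `μ < 0`, so minimizing sequences are precompact. No compact
embedding is needed. -/
theorem exists_neg_weak_eigenvalue [CompleteSpace X] (B M : X →ₗ[ℝ] X →ₗ[ℝ] ℝ)
    (hB : ∀ x y, B x y = B y x) (hM : ∀ x y, M x y = M y x)
    (hBc : Continuous fun x => B x x) (hMc : Continuous fun x => M x x)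
    (hM0 : ∀ x, 0 ≤ M x x) {C δ : ℝ} (hδ : 0 < δ)
    (hG : ∀ x, δ * ‖x‖ ^ 2 ≤ B x x + C * M x x) (l : X →L[ℝ] ℝ)
    (hl : ∀ x, l x = 0 → 0 ≤ B x x) {e : X} (he : B e e < 0) :
    ∃ μ < 0, ∃ x, x ≠ 0 ∧ ∀ y, B x y = μ * M x y := by
  have hMe : 0 < M e e := by
    refine lt_of_le_of_ne (hM0 e) fun h => ?_
    have := hG e
    rw [← h] at this
    have : 0 ≤ δ * ‖e‖ ^ 2 := by positivity
    linarith
  have hle : l e ≠ 0 := fun h => absurd (hl e h) (not_le.2 he)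
  have hnorm : ∀ x, 0 < M x x → M ((√(M x x))⁻¹ • x) ((√(M x x))⁻¹ • x) = 1 ∧
      B ((√(M x x))⁻¹ • x) ((√(M x x))⁻¹ • x) = B x x / M x x := by
    intro x hx
    rw [bilin_apply_smul_smul, bilin_apply_smul_smul, inv_pow, Real.sq_sqrt hx.le]
    exact ⟨inv_mul_cancel₀ hx.ne', by rw [div_eq_inv_mul]⟩
  set Q : Set ℝ := {q | ∃ x, M x x = 1 ∧ B x x = q} with hQ
  have hne : Q.Nonempty := ⟨_, _, hnorm e hMe⟩
  have hbdd : BddBelow Q := ⟨-C, by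
    rintro q ⟨x, h1, rfl⟩
    have := hG x
    rw [h1] at this
    have : 0 ≤ δ * ‖x‖ ^ 2 := by positivity
    linarith⟩
  set μ := sInf Q with hμ
  have hμ0 : μ < 0 := lt_of_le_of_lt (csInf_le hbdd ⟨_, hnorm e hMe⟩) (div_neg_of_neg_of_pos he hMe)
  set N : X →ₗ[ℝ] X →ₗ[ℝ] ℝ := B - μ • M with hNdef
  have hNa : ∀ x y, N x y = B x y - μ * M x y := fun x y => rfl
  have hN : ∀ x y, N x y = N y x := fun x y => by rw [hNa, hNa, hB, hM]
  have hN0 : ∀ x, 0 ≤ N x x := by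
    intro x
    rw [hNa]
    rcases (hM0 x).eq_or_lt with h | h
    · have := hG x
      rw [← h] at this ⊢
      have : 0 ≤ δ * ‖x‖ ^ 2 := by positivity
      linarith
    · have := csInf_le hbdd ⟨_, hnorm x h⟩
      rw [← hμ, le_div_iff₀ h] at this
      linarith
  have hC : 0 < C := by
    by_contra hC
    have h1 := hG e
    have h2 : 0 ≤ δ * ‖e‖ ^ 2 := by positivity
    have := mul_nonpos_of_nonpos_of_nonneg (not_lt.1 hC) (hM0 e)
    linarith
  -- On the hyperplane, `B - μ M` dominates the multiple `s` of `B + C M`, since `B ≥ 0` there.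
  set s := min 1 (-μ / C) with hs
  have hs0 : 0 < s := lt_min one_pos (div_pos (neg_pos.2 hμ0) hC)
  have hco : ∀ x, l x = 0 → s * δ * ‖x‖ ^ 2 ≤ N x x := by
    intro x hx
    have h1 := mul_le_mul_of_nonneg_left (hG x) hs0.le
    have h2 : s * B x x ≤ B x x := by
      have := mul_le_mul_of_nonneg_right (min_le_left 1 (-μ / C)) (hl x hx)
      rwa [one_mul] at this
    have h3 : s * C ≤ -μ := by
      have := mul_le_mul_of_nonneg_right (min_le_right 1 (-μ / C)) hC.le
      rwa [div_mul_cancel₀ _ hC.ne'] at this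
    have h4 := mul_le_mul_of_nonneg_right h3 (hM0 x)
    rw [hNa]
    linarith
  obtain ⟨q, -, hqt, hqQ⟩ := exists_seq_tendsto_sInf hne hbdd
  choose x hx1 hxq using hqQ
  have hNx : Tendsto (fun n => N (x n) (x n)) atTop (𝓝 0) := by
    have := hqt.sub_const μ
    rw [sub_self] at this
    refine this.congr fun n => ?_
    rw [hNa, hx1, hxq, mul_one]
  obtain ⟨K, hK⟩ := hqt.bddAbove_range
  have hxR : ∀ n, ‖x n‖ ≤ √((K + C) / δ) := by
    intro n
    refine Real.le_sqrt_of_sq_le ?_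
    rw [le_div_iff₀ hδ]
    have h1 := hG (x n)
    rw [hx1, hxq] at h1
    have := hK ⟨n, rfl⟩
    linarith
  obtain ⟨φ, a, hφ, ha⟩ := exists_tendsto_subseq_of_coercive_on_ker N hN hN0 l
    (e := (l e)⁻¹ • e) (by simp [hle]) (mul_pos hs0 hδ) hco hxR hNx
  have hMa : M a a = 1 := by
    have h1 := (hMc.tendsto a).comp ha
    refine tendsto_nhds_unique h1 ?_
    simp [Function.comp_def, hx1]
  have hNa0 : N a a = 0 := by
    have hNc : Continuous fun x => N x x := hBc.sub (hMc.const_mul μ)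
    exact tendsto_nhds_unique ((hNc.tendsto a).comp ha) (hNx.comp hφ.tendsto_atTop)
  refine ⟨μ, hμ0, a, ?_, fun y => ?_⟩
  · rintro rfl
    simp at hMa
  · have := bilin_eq_zero_of_self_eq_zero N hN hN0 hNa0 y
    rw [hNa] at this
    linarith

end Variational

/-! ### Symmetric operators that are nonnegative on a hyperplane -/

section SymmetricOperators

variable {E : Type*} [NormedAddCommGroup E] [InnerProductSpace ℝ E]

/-- For a symmetric operator, an eigenvalue with one-dimensional eigenspace is simple. -/
theorem isSimpleEigenvalue_of_symmetric {T : E →ₗ.[ℝ] E}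
    (hT : ∀ x y : T.domain, ⟪T x, (y : E)⟫ = ⟪(x : E), T y⟫) {μ : ℝ} {v : E} (hv0 : v ≠ 0)
    (hv : v ∈ opEigenspace T μ) (hs : ∀ x ∈ opEigenspace T μ, ∃ r : ℝ, r • v = x) :
    IsSimpleEigenvalue T μ := by
  refine ⟨?_, fun x ⟨y, hy, hTy⟩ => ?_⟩
  · refine (finrank_eq_one_iff_of_nonzero' (⟨v, hv⟩ : opEigenspace T μ) ?_).2 fun w => ?_
    · exact fun h => hv0 (congrArg Subtype.val h)
    · obtain ⟨r, hr⟩ := hs w w.2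
      exact ⟨r, Subtype.ext hr⟩
  · have h1 : ⟪T x - μ • (x : E), (y : E)⟫ = 0 := by
      rw [inner_sub_left, hT x y, hTy, inner_smul_left, inner_smul_right, hy]
      simp
    rw [hy] at h1
    exact inner_self_eq_zero.1 h1

/-- If a symmetric operator is nonnegative on a hyperplane, then orthogonal eigenvectors with
negative eigenvalues cannot both be nonzero: some combination of them lies in the hyperplane. -/
theorem eq_zero_or_eq_zero_of_orthogonal_neg {T : E →ₗ.[ℝ] E} (l : E →ₗ[ℝ] ℝ)
    (hl : ∀ x : T.domain, l x = 0 → 0 ≤ ⟪T x, (x : E)⟫) {μ ν : ℝ} (hμ : μ < 0) (hν : ν < 0)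
    {x y : T.domain} (hx : T x = μ • (x : E)) (hy : T y = ν • (y : E))
    (hxy : ⟪(x : E), (y : E)⟫ = 0) : (x : E) = 0 ∨ (y : E) = 0 := by
  have key : ∀ (z : T.domain) (κ : ℝ), κ < 0 → T z = κ • (z : E) → l z = 0 → (z : E) = 0 := by
    intro z κ hκ hz hlz
    have h1 := hl z hlz
    rw [hz, inner_smul_left, real_inner_self_eq_norm_sq] at h1
    simp only [conj_trivial] at h1
    by_contra hne
    have : 0 < ‖(z : E)‖ ^ 2 := by positivity
    nlinarith
  by_cases hly : l y = 0
  · exact Or.inr (key y ν hν hy hly)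
  left
  have h1 := hl (l y • x - l x • y) (by
    rw [Submodule.coe_sub, map_sub, Submodule.coe_smul, Submodule.coe_smul, map_smul, map_smul,
      smul_eq_mul, smul_eq_mul]
    ring)
  rw [LinearPMap.map_sub, LinearPMap.map_smul, LinearPMap.map_smul, hx, hy, Submodule.coe_sub,
    Submodule.coe_smul, Submodule.coe_smul] at h1
  have hyx : ⟪(y : E), (x : E)⟫ = 0 := by rw [real_inner_comm]; exact hxy
  simp only [inner_sub_left, inner_sub_right, inner_smul_left, inner_smul_right, conj_trivial, hxy,
    hyx, real_inner_self_eq_norm_sq] at h1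
  by_contra hne
  have h2 : 0 < ‖(x : E)‖ ^ 2 := by positivity
  have h3 : 0 < l y ^ 2 * ‖(x : E)‖ ^ 2 := mul_pos (by positivity) h2
  have h4 : 0 ≤ l x ^ 2 * ‖(y : E)‖ ^ 2 := by positivity
  nlinarith [mul_pos (neg_pos.2 hμ) h3, mul_nonneg (neg_pos.2 hν).le h4]

/-- A symmetric operator which is nonnegative on a hyperplane has at most one negative eigenvalue,
and this eigenvalue is simple. -/
theorem exists_unique_simple_neg_eigenvalue {T : E →ₗ.[ℝ] E}
    (hT : ∀ x y : T.domain, ⟪T x, (y : E)⟫ = ⟪(x : E), T y⟫) (l : E →ₗ[ℝ] ℝ)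
    (hl : ∀ x : T.domain, l x = 0 → 0 ≤ ⟪T x, (x : E)⟫) {μ : ℝ} (hμ : μ < 0) {x : T.domain}
    (hx0 : (x : E) ≠ 0) (hx : T x = μ • (x : E)) :
    IsSimpleEigenvalue T μ ∧ ∀ ν < 0, IsEigenvalue T ν → ν = μ := by
  refine ⟨isSimpleEigenvalue_of_symmetric hT hx0 ⟨x, rfl, hx⟩ ?_, fun ν hν hνe => ?_⟩
  · rintro _ ⟨y, rfl, hy⟩
    set r := ⟪(x : E), (y : E)⟫ / ‖(x : E)‖ ^ 2 with hr
    refine ⟨r, ?_⟩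
    have h1 := eq_zero_or_eq_zero_of_orthogonal_neg l hl hμ hμ (x := x) (y := y - r • x) hx (by
      rw [LinearPMap.map_sub, LinearPMap.map_smul, hx, hy, Submodule.coe_sub, Submodule.coe_smul,
        smul_sub, smul_comm]) (by
      rw [Submodule.coe_sub, Submodule.coe_smul, inner_sub_right, inner_smul_right,
        real_inner_self_eq_norm_sq, hr]
      have : ‖(x : E)‖ ^ 2 ≠ 0 := by positivity
      field_simp
      ring)
    have h2 := h1.resolve_left hx0
    rw [Submodule.coe_sub, Submodule.coe_smul, sub_eq_zero] at h2
    exact h2.symm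
  · by_contra hne
    obtain ⟨_, ⟨y, rfl, hy⟩, hy0⟩ := Submodule.exists_mem_ne_zero_of_ne_bot hνe
    have h1 := hT x y
    rw [hx, hy, inner_smul_left, inner_smul_right, conj_trivial] at h1
    have h2 : ⟪(x : E), (y : E)⟫ = 0 := by
      have : (μ - ν) * ⟪(x : E), (y : E)⟫ = 0 := by linarith
      exact (mul_eq_zero.1 this).resolve_left (sub_ne_zero.2 (Ne.symm hne))
    exact (eq_zero_or_eq_zero_of_orthogonal_neg l hl hμ hν hx hy h2).elim hx0 hy0

end SymmetricOperators

/-! ### Matrix Schrödinger operators and their forms -/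

/-- The underlying function of an element of `H¹(ℝ)`. -/
noncomputable def H1R.val : H1R →L[ℝ] L2R where
  toFun p := (p : WithLp 2 (L2R × L2R)).fst
  map_add' _ _ := rfl
  map_smul' _ _ := rfl
  cont := (WithLp.continuous_fst 2 L2R L2R).comp continuous_subtype_val

/-- The weak derivative of an element of `H¹(ℝ)`. -/
noncomputable def H1R.der : H1R →L[ℝ] L2R where
  toFun p := (p : WithLp 2 (L2R × L2R)).snd
  map_add' _ _ := rfl
  map_smul' _ _ := rfl
  cont := (WithLp.continuous_snd 2 L2R L2R).comp continuous_subtype_val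

theorem H1R.isWeakDeriv (p : H1R) : IsWeakDeriv (H1R.val p) (H1R.der p) := p.2

theorem H1R.norm_sq (p : H1R) : ‖p‖ ^ 2 = ‖H1R.val p‖ ^ 2 + ‖H1R.der p‖ ^ 2 :=
  WithLp.prod_norm_sq_eq_of_L2 (p : WithLp 2 (L2R × L2R))

/-- The element of `H¹(ℝ)` given by a function and its weak derivative. -/
noncomputable def H1R.mk {f g : L2R} (h : IsWeakDeriv f g) : H1R := ⟨WithLp.toLp 2 (f, g), h⟩

theorem H1R.val_mk {f g : L2R} (h : IsWeakDeriv f g) : H1R.val (H1R.mk h) = f := rfl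

theorem H1R.der_mk {f g : L2R} (h : IsWeakDeriv f g) : H1R.der (H1R.mk h) = g := rfl

/-- The form domain `(H¹(ℝ))ⁿ`. -/
abbrev H1Rn (n : ℕ) : Type := PiLp 2 fun _ : Fin n => H1R

noncomputable instance (n : ℕ) : NormedSpace ℝ (H1Rn n) := PiLp.normedSpace 2 ℝ _

/-- The bilinear form of `matrixSchrodinger d V`, on `(H¹(ℝ))ⁿ`. -/
noncomputable def schrodingerForm {n : ℕ} (d : Fin n → ℝ) (V : Matrix (Fin n) (Fin n) (ℝ →ᵇ ℝ)) :
    H1Rn n →ₗ[ℝ] H1Rn n →ₗ[ℝ] ℝ :=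
  LinearMap.mk₂ ℝ (fun x y => ∑ i, (d i * ⟪H1R.der (x i), H1R.der (y i)⟫ +
      ∑ j, ⟪mulOp (V i j) (H1R.val (x j)), H1R.val (y i)⟫))
    (fun x x' y => by
      simp only [PiLp.add_apply, map_add, inner_add_left, mul_add, Finset.sum_add_distrib]
      ring)
    (fun r x y => by
      simp only [PiLp.smul_apply, map_smul, inner_smul_left, conj_trivial, smul_eq_mul,
        Finset.mul_sum, mul_add, mul_left_comm])
    (fun x y y' => by
      simp only [PiLp.add_apply, map_add, inner_add_right, mul_add, Finset.sum_add_distrib]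
      ring)
    (fun r x y => by
      simp only [PiLp.smul_apply, map_smul, inner_smul_right, smul_eq_mul,
        Finset.mul_sum, mul_add, mul_left_comm])

/-- The `L²` inner product, on `(H¹(ℝ))ⁿ`. -/
noncomputable def massForm (n : ℕ) : H1Rn n →ₗ[ℝ] H1Rn n →ₗ[ℝ] ℝ :=
  LinearMap.mk₂ ℝ (fun x y => ∑ i, ⟪H1R.val (x i), H1R.val (y i)⟫)
    (fun x x' y => by
      simp only [PiLp.add_apply, map_add, inner_add_left, Finset.sum_add_distrib])
    (fun r x y => by
      simp only [PiLp.smul_apply, map_smul, inner_smul_left, conj_trivial, smul_eq_mul,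
        Finset.mul_sum])
    (fun x y y' => by
      simp only [PiLp.add_apply, map_add, inner_add_right, Finset.sum_add_distrib])
    (fun r x y => by
      simp only [PiLp.smul_apply, map_smul, inner_smul_right, smul_eq_mul, Finset.mul_sum])

theorem schrodingerForm_apply {n : ℕ} (d : Fin n → ℝ) (V : Matrix (Fin n) (Fin n) (ℝ →ᵇ ℝ))
    (x y : H1Rn n) : schrodingerForm d V x y = ∑ i, (d i * ⟪H1R.der (x i), H1R.der (y i)⟫ +
      ∑ j, ⟪mulOp (V i j) (H1R.val (x j)), H1R.val (y i)⟫) := rfl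

theorem massForm_apply {n : ℕ} (x y : H1Rn n) :
    massForm n x y = ∑ i, ⟪H1R.val (x i), H1R.val (y i)⟫ := rfl

theorem schrodingerForm_symm {n : ℕ} {d : Fin n → ℝ} {V : Matrix (Fin n) (Fin n) (ℝ →ᵇ ℝ)}
    (hV : ∀ i j, V i j = V j i) (x y : H1Rn n) :
    schrodingerForm d V x y = schrodingerForm d V y x := by
  simp only [schrodingerForm_apply, Finset.sum_add_distrib]
  congr 1
  · exact Finset.sum_congr rfl fun i _ => by rw [real_inner_comm]
  · rw [Finset.sum_comm]
    exact Finset.sum_congr rfl fun i _ => Finset.sum_congr rfl fun j _ => by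
      rw [inner_mulOp_symm, real_inner_comm, hV]

theorem massForm_symm {n : ℕ} (x y : H1Rn n) : massForm n x y = massForm n y x := by
  rw [massForm_apply, massForm_apply]
  exact Finset.sum_congr rfl fun i _ => real_inner_comm _ _

theorem continuous_schrodingerForm_self {n : ℕ} (d : Fin n → ℝ)
    (V : Matrix (Fin n) (Fin n) (ℝ →ᵇ ℝ)) : Continuous fun x => schrodingerForm d V x x := by
  have hp : ∀ i, Continuous fun x : H1Rn n => x i := fun i => PiLp.continuous_apply 2 _ i
  simp only [schrodingerForm_apply]
  refine continuous_finsetSum _ fun i _ => Continuous.add ?_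
    (continuous_finsetSum _ fun j _ => ?_)
  · exact continuous_const.mul
      ((H1R.der.continuous.comp (hp i)).inner (H1R.der.continuous.comp (hp i)))
  · exact ((continuous_mulOp _).comp (H1R.val.continuous.comp (hp j))).inner
      (H1R.val.continuous.comp (hp i))

theorem continuous_massForm_self (n : ℕ) : Continuous fun x => massForm n x x := by
  have hp : ∀ i, Continuous fun x : H1Rn n => x i := fun i => PiLp.continuous_apply 2 _ i
  simp only [massForm_apply]
  exact continuous_finsetSum _ fun i _ =>
    (H1R.val.continuous.comp (hp i)).inner (H1R.val.continuous.comp (hp i))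

theorem massForm_self_nonneg {n : ℕ} (x : H1Rn n) : 0 ≤ massForm n x x := by
  rw [massForm_apply]
  exact Finset.sum_nonneg fun _ _ => real_inner_self_nonneg

/-- The Gårding inequality: the potential is a bounded perturbation of the kinetic energy. -/
theorem exists_garding {n : ℕ} {d : Fin n → ℝ} {m : ℝ} (hd : ∀ i, m ≤ d i)
    (V : Matrix (Fin n) (Fin n) (ℝ →ᵇ ℝ)) :
    ∃ C : ℝ, ∀ x, m * ‖x‖ ^ 2 ≤ schrodingerForm d V x x + C * massForm n x x := by
  set K : ℝ := ∑ i, ∑ j, ‖V i j‖ with hK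
  refine ⟨K + m, fun x => ?_⟩
  have hm : massForm n x x = ∑ i, ‖H1R.val (x i)‖ ^ 2 := by
    simp only [massForm_apply, real_inner_self_eq_norm_sq]
  have hle : ∀ i, ‖H1R.val (x i)‖ ^ 2 ≤ massForm n x x := fun i => by
    rw [hm]
    exact Finset.single_le_sum (f := fun i => ‖H1R.val (x i)‖ ^ 2) (fun _ _ => by positivity)
      (Finset.mem_univ i)
  have hV : -(K * massForm n x x) ≤ ∑ i, ∑ j, ⟪mulOp (V i j) (H1R.val (x j)), H1R.val (x i)⟫ := by
    rw [hK, Finset.sum_mul, ← Finset.sum_neg_distrib]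
    refine Finset.sum_le_sum fun i _ => ?_
    rw [Finset.sum_mul, ← Finset.sum_neg_distrib]
    refine Finset.sum_le_sum fun j _ => ?_
    refine neg_le_of_abs_le ((abs_real_inner_le_norm _ _).trans ?_)
    have h1 := mul_le_mul_of_nonneg_right (norm_mulOp_le (V i j) (H1R.val (x j)))
      (norm_nonneg (H1R.val (x i)))
    have h2 : ‖H1R.val (x j)‖ * ‖H1R.val (x i)‖ ≤ massForm n x x := by
      have := two_mul_le_add_sq ‖H1R.val (x j)‖ ‖H1R.val (x i)‖
      linarith [hle i, hle j]
    have h3 := mul_le_mul_of_nonneg_left h2 (norm_nonneg (V i j))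
    linarith
  have hD : m * ∑ i, ‖H1R.der (x i)‖ ^ 2 ≤ ∑ i, d i * ⟪H1R.der (x i), H1R.der (x i)⟫ := by
    rw [Finset.mul_sum]
    refine Finset.sum_le_sum fun i _ => ?_
    rw [real_inner_self_eq_norm_sq]
    exact mul_le_mul_of_nonneg_right (hd i) (by positivity)
  have hn : ‖x‖ ^ 2 = massForm n x x + ∑ i, ‖H1R.der (x i)‖ ^ 2 := by
    rw [PiLp.norm_sq_eq_of_L2, hm, ← Finset.sum_add_distrib]
    exact Finset.sum_congr rfl fun i _ => H1R.norm_sq _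
  rw [hn, schrodingerForm_apply, Finset.sum_add_distrib]
  linarith

/-- Elements of the operator domain lie in the form domain. -/
theorem exists_H1Rn_of_mem_H2Rn {n : ℕ} {f : L2Rn n} (hf : f ∈ H2Rn n) :
    ∃ x : H1Rn n, ∀ i, H1R.val (x i) = f i ∧ IsWeakDeriv (H1R.der (x i)) (deriv2 ⟨f i, hf i⟩) := by
  choose g hg hh using fun i => deriv2_spec ⟨f i, hf i⟩
  exact ⟨WithLp.toLp 2 fun i => H1R.mk (hg i), fun i => ⟨rfl, hh i⟩⟩

theorem matrixSchrodinger_apply {n : ℕ} (d : Fin n → ℝ) (V : Matrix (Fin n) (Fin n) (ℝ →ᵇ ℝ))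
    (f : (matrixSchrodinger d V).domain) (i : Fin n) :
    (matrixSchrodinger d V f : L2Rn n) i = -(d i • deriv2 ⟨(f : L2Rn n) i, f.2 i⟩) +
      ∑ j, mulOp (V i j) ((f : L2Rn n) j) := rfl

/-- The operator represents its form. -/
theorem inner_matrixSchrodinger {n : ℕ} {d : Fin n → ℝ} {V : Matrix (Fin n) (Fin n) (ℝ →ᵇ ℝ)}
    (f : (matrixSchrodinger d V).domain) {x y : H1Rn n} {g : L2Rn n}
    (hx : ∀ i, H1R.val (x i) = (f : L2Rn n) i ∧
      IsWeakDeriv (H1R.der (x i)) (deriv2 ⟨(f : L2Rn n) i, f.2 i⟩))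
    (hy : ∀ i, H1R.val (y i) = g i) :
    ⟪(matrixSchrodinger d V f : L2Rn n), g⟫ = schrodingerForm d V x y := by
  rw [PiLp.inner_apply, schrodingerForm_apply]
  refine Finset.sum_congr rfl fun i _ => ?_
  rw [matrixSchrodinger_apply, inner_add_left, inner_neg_left, inner_smul_left, conj_trivial,
    sum_inner, ← hy i]
  have h1 := (hx i).2.inner_add_inner_eq_zero (H1R.isWeakDeriv (y i))
  have h2 : ∀ j, H1R.val (x j) = (f : L2Rn n) j := fun j => (hx j).1
  simp only [h2]
  linear_combination (-d i) * h1

theorem matrixSchrodinger_symmetric {n : ℕ} {d : Fin n → ℝ}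
    {V : Matrix (Fin n) (Fin n) (ℝ →ᵇ ℝ)} (hV : ∀ i j, V i j = V j i)
    (f g : (matrixSchrodinger d V).domain) :
    ⟪(matrixSchrodinger d V f : L2Rn n), (g : L2Rn n)⟫ =
      ⟪(f : L2Rn n), (matrixSchrodinger d V g : L2Rn n)⟫ := by
  obtain ⟨x, hx⟩ := exists_H1Rn_of_mem_H2Rn f.2
  obtain ⟨y, hy⟩ := exists_H1Rn_of_mem_H2Rn g.2
  rw [real_inner_comm (matrixSchrodinger d V g : L2Rn n),
    inner_matrixSchrodinger f hx fun i => (hy i).1, inner_matrixSchrodinger g hy fun i => (hx i).1,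
    schrodingerForm_symm hV]

/-- The operator on functions whose two weak derivatives are known. -/
theorem exists_matrixSchrodinger_apply_eq {n : ℕ} (d : Fin n → ℝ)
    (V : Matrix (Fin n) (Fin n) (ℝ →ᵇ ℝ)) {f g h : Fin n → L2R}
    (hg : ∀ i, IsWeakDeriv (f i) (g i)) (hh : ∀ i, IsWeakDeriv (g i) (h i)) :
    ∃ F : (matrixSchrodinger d V).domain, (F : L2Rn n) = WithLp.toLp 2 f ∧
      ∀ i, (matrixSchrodinger d V F : L2Rn n) i = -(d i • h i) + ∑ j, mulOp (V i j) (f j) := by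
  have hmem : WithLp.toLp 2 f ∈ H2Rn n := fun i => ⟨g i, h i, hg i, hh i⟩
  refine ⟨⟨WithLp.toLp 2 f, hmem⟩, rfl, fun i => ?_⟩
  have h1 : deriv2 ⟨f i, hmem i⟩ = h i := by
    obtain ⟨k, hk, hl⟩ := deriv2_spec ⟨f i, hmem i⟩
    exact H2R.deriv2_unique hk hl (hg i) (hh i)
  rw [matrixSchrodinger_apply]
  exact congrArg (fun t => -(d i • t) + ∑ j, mulOp (V i j) (f j)) h1

/-- Weak eigenvectors in the form domain are eigenvectors: the weak equation expresses the second
derivative through `L²` functions. -/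
theorem exists_eigenvector_of_weak {n : ℕ} {d : Fin n → ℝ} (hd : ∀ i, 0 < d i)
    {V : Matrix (Fin n) (Fin n) (ℝ →ᵇ ℝ)} {μ : ℝ} {x : H1Rn n} (hx0 : x ≠ 0)
    (hx : ∀ y, schrodingerForm d V x y = μ * massForm n x y) :
    ∃ f : (matrixSchrodinger d V).domain, (f : L2Rn n) ≠ 0 ∧
      matrixSchrodinger d V f = μ • (f : L2Rn n) := by
  have hh : ∀ i, IsWeakDeriv (H1R.der (x i))
      ((d i)⁻¹ • (∑ j, mulOp (V i j) (H1R.val (x j)) - μ • H1R.val (x i))) := by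
    intro i
    refine isWeakDeriv_iff_inner.2 fun φ hφ hc => ?_
    have h1 := hx (WithLp.toLp 2 (Pi.single i (H1R.mk (isWeakDeriv_test hφ hc))))
    rw [schrodingerForm_apply, massForm_apply,
      Finset.sum_eq_single i (fun j _ hj => by simp [Pi.single_eq_of_ne hj]) (by simp),
      Finset.sum_eq_single (f := fun j => ⟪H1R.val (x j), _⟫) i
        (fun j _ hj => by simp [Pi.single_eq_of_ne hj]) (by simp)] at h1
    simp only [Pi.single_eq_same, H1R.val_mk, H1R.der_mk] at h1
    rw [inner_smul_left, conj_trivial, inner_sub_left, sum_inner, inner_smul_left, conj_trivial]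
    have := (hd i).ne'
    field_simp
    linarith
  obtain ⟨F, hF, hLF⟩ := exists_matrixSchrodinger_apply_eq d V (fun i => H1R.isWeakDeriv (x i)) hh
  refine ⟨F, fun h0 => hx0 ?_, ?_⟩
  · ext1 i
    have h1 : H1R.val (x i) = 0 := by
      have : (F : L2Rn n) i = 0 := by rw [h0]; rfl
      rwa [hF] at this
    have h2 : H1R.der (x i) = 0 := by
      have := H1R.isWeakDeriv (x i)
      rw [h1] at this
      exact this.unique .zero
    exact Subtype.ext (WithLp.ofLp_injective 2 (Prod.ext h1 h2))
  · ext1 i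
    rw [hLF, hF, smul_smul, mul_inv_cancel₀ (hd i).ne', one_smul, PiLp.smul_apply]
    simp

/-- A matrix Schrödinger operator which is nonnegative on a hyperplane, but not nonnegative, has
exactly one negative eigenvalue, and it is simple. -/
theorem matrixSchrodinger_exists_unique_neg {n : ℕ} {d : Fin n → ℝ} {m : ℝ} (hm : 0 < m)
    (hd : ∀ i, m ≤ d i) {V : Matrix (Fin n) (Fin n) (ℝ →ᵇ ℝ)} (hV : ∀ i j, V i j = V j i)
    (s : L2Rn n) (hs : ∀ x : H1Rn n, ∑ i, ⟪s i, H1R.val (x i)⟫ = 0 → 0 ≤ schrodingerForm d V x x)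
    {e : H1Rn n} (he : schrodingerForm d V e e < 0) :
    ∃ μ < 0, IsSimpleEigenvalue (matrixSchrodinger d V) μ ∧
      ∀ ν < 0, IsEigenvalue (matrixSchrodinger d V) ν → ν = μ := by
  obtain ⟨C, hC⟩ := exists_garding hd V
  let l : H1Rn n →L[ℝ] ℝ := ∑ i, (innerSL ℝ (s i)).comp
    (H1R.val.comp (PiLp.proj 2 (fun _ : Fin n => H1R) i))
  have hl : ∀ x : H1Rn n, l x = ∑ i, ⟪s i, H1R.val (x i)⟫ := fun x => by simp [l]
  obtain ⟨μ, hμ, x, hx0, hx⟩ := exists_neg_weak_eigenvalue (schrodingerForm d V) (massForm n)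
    (schrodingerForm_symm hV) massForm_symm (continuous_schrodingerForm_self d V)
    (continuous_massForm_self n) massForm_self_nonneg hm hC l
    (fun x h => hs x (by rw [← hl, h])) he
  obtain ⟨f, hf0, hf⟩ := exists_eigenvector_of_weak (fun i => hm.trans_le (hd i)) hx0 hx
  refine ⟨μ, hμ, exists_unique_simple_neg_eigenvalue (matrixSchrodinger_symmetric hV)
    (innerSL ℝ s : L2Rn n →ₗ[ℝ] ℝ) (fun g hg => ?_) hμ hf0 hf⟩
  obtain ⟨y, hy⟩ := exists_H1Rn_of_mem_H2Rn g.2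
  rw [inner_matrixSchrodinger g hy fun i => (hy i).1]
  refine hs y ?_
  have h1 : ⟪s, (g : L2Rn n)⟫ = 0 := hg
  rw [PiLp.inner_apply] at h1
  rw [← h1]
  exact Finset.sum_congr rfl fun i _ => by rw [(hy i).1]

/-! ### The normalized block -/

theorem integrable_bcf_mul_mul (V : ℝ →ᵇ ℝ) (f g : L2R) : Integrable fun x => V x * f x * g x :=
  (memLp_bcf_mul V f).integrable_mul (q := 2) (Lp.memLp g)

theorem inner_add_inner_eq_integral_scalarDensity {b : ℝ} {V : ℝ →ᵇ ℝ}
    (hV : ∀ x, V x = 12 * (b ^ 2 - 2 * b ^ 2 * sechB b x ^ 2)) (z z' : L2R) :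
    12 * ⟪z', z'⟫ + ⟪mulOp V z, z⟫ = 12 * ∫ x, scalarDensity b z z' x := by
  have i1 : Integrable fun x => z' x * z' x := (Lp.memLp z').integrable_mul (q := 2) (Lp.memLp z')
  rw [L2R.inner_eq_integral, inner_mulOp, ← integral_const_mul, ← integral_const_mul,
    ← integral_add (i1.const_mul 12) (integrable_bcf_mul_mul V z z)]
  refine integral_congr_ae (Filter.Eventually.of_forall fun x => ?_)
  simp only [scalarDensity, hV]
  ring

theorem inner_add_inner_eq_integral_blockDensity {b c ρ : ℝ} {V₁₁ V₁₂ V₂₁ V₂₂ : ℝ →ᵇ ℝ}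
    (h₁₁ : ∀ x, V₁₁ x = c - 12 * b ^ 2 * sechB b x ^ 2) (h₁₂ : ∀ x, V₁₂ x = -(12 * ρ) * sechB b x)
    (h₂₁ : ∀ x, V₂₁ x = -(12 * ρ) * sechB b x)
    (h₂₂ : ∀ x, V₂₂ x = 12 * (b ^ 2 - 2 * b ^ 2 * sechB b x ^ 2)) (w w' z z' : L2R) :
    ⟪w', w'⟫ + (⟪mulOp V₁₁ w, w⟫ + ⟪mulOp V₁₂ z, w⟫) +
      (12 * ⟪z', z'⟫ + (⟪mulOp V₂₁ w, z⟫ + ⟪mulOp V₂₂ z, z⟫)) =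
      ∫ x, blockDensity b c ρ w w' z z' x := by
  have i0 : ∀ f : L2R, Integrable fun x => f x * f x := fun f =>
    (Lp.memLp f).integrable_mul (q := 2) (Lp.memLp f)
  have i1 := integrable_bcf_mul_mul V₁₁ w w
  have i2 := integrable_bcf_mul_mul V₁₂ z w
  have i3 := integrable_bcf_mul_mul V₂₁ w z
  have i4 := integrable_bcf_mul_mul V₂₂ z z
  have i12 : Integrable fun x => V₁₁ x * w x * w x + V₁₂ x * z x * w x := i1.add i2
  have i34 : Integrable fun x => V₂₁ x * w x * z x + V₂₂ x * z x * z x := i3.add i4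
  have i5 : Integrable fun x =>
      w' x * w' x + (V₁₁ x * w x * w x + V₁₂ x * z x * w x) := (i0 w').add i12
  have i6 : Integrable fun x =>
      12 * (z' x * z' x) + (V₂₁ x * w x * z x + V₂₂ x * z x * z x) := ((i0 z').const_mul 12).add i34
  simp only [L2R.inner_eq_integral w', L2R.inner_eq_integral z', inner_mulOp]
  rw [← integral_const_mul, ← integral_add i1 i2, ← integral_add (i0 w') i12, ← integral_add i3 i4,
    ← integral_add ((i0 z').const_mul 12) i34, ← integral_add i5 i6]
  refine integral_congr_ae (Filter.Eventually.of_forall fun x => ?_)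
  simp only [blockDensity, scalarDensity, h₁₁, h₁₂, h₂₁, h₂₂]
  ring

/-- The potential matrix of `normalizedHessianBlock γ`. -/
noncomputable def normalizedPotential (γ : ℝ) : Matrix (Fin 2) (Fin 2) (ℝ →ᵇ ℝ) :=
  !![γ • 1 - (12 : ℝ) • sechB 1 ^ 2, (-(4 * √(3 * (γ - 4)))) • sechB 1;
     (-(4 * √(3 * (γ - 4)))) • sechB 1, (12 : ℝ) • (1 - (2 : ℝ) • sechB 1 ^ 2)]

theorem normalizedHessianBlock_eq (γ : ℝ) :
    normalizedHessianBlock γ = matrixSchrodinger ![1, 12] (normalizedPotential γ) := rfl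

theorem normalizedPotential_symm (γ : ℝ) (i j : Fin 2) :
    normalizedPotential γ i j = normalizedPotential γ j i := by
  fin_cases i <;> fin_cases j <;> rfl

/-- The coupling constant `ρ` of the normalized block, for which `3 ρ² = γ - 4`. -/
noncomputable def normalizedCoupling (γ : ℝ) : ℝ := √(3 * (γ - 4)) / 3

theorem normalizedCoupling_sq {γ : ℝ} (hγ : 4 < γ) :
    3 * normalizedCoupling γ ^ 2 = 1 ^ 2 * (γ - 4 * 1 ^ 2) := by
  rw [normalizedCoupling, div_pow, Real.sq_sqrt (by linarith)]
  ring

theorem normalizedCoupling_pos {γ : ℝ} (hγ : 4 < γ) : 0 < normalizedCoupling γ :=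
  div_pos (Real.sqrt_pos.2 (by linarith)) (by norm_num)

theorem normalizedPotential_zero_zero (γ x : ℝ) :
    normalizedPotential γ 0 0 x = γ - 12 * 1 ^ 2 * sechB 1 x ^ 2 := by
  simp [normalizedPotential]

theorem normalizedPotential_zero_one (γ x : ℝ) :
    normalizedPotential γ 0 1 x = -(12 * normalizedCoupling γ) * sechB 1 x := by
  simp only [normalizedPotential, normalizedCoupling, Matrix.of_apply, Matrix.cons_val_zero,
    Matrix.cons_val_one, BoundedContinuousFunction.smul_apply, smul_eq_mul]
  ring

theorem normalizedPotential_one_one (γ x : ℝ) :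
    normalizedPotential γ 1 1 x = 12 * (1 ^ 2 - 2 * 1 ^ 2 * sechB 1 x ^ 2) := by
  simp [normalizedPotential]

theorem schrodingerForm_normalizedPotential (γ : ℝ) (x : H1Rn 2) :
    schrodingerForm ![1, 12] (normalizedPotential γ) x x =
      ∫ t, blockDensity 1 γ (normalizedCoupling γ) (H1R.val (x 0)) (H1R.der (x 0))
        (H1R.val (x 1)) (H1R.der (x 1)) t := by
  rw [← inner_add_inner_eq_integral_blockDensity (normalizedPotential_zero_zero γ)
    (normalizedPotential_zero_one γ)
    (V₂₁ := normalizedPotential γ 1 0)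
    (fun t => by rw [normalizedPotential_symm, normalizedPotential_zero_one])
    (normalizedPotential_one_one γ), schrodingerForm_apply]
  simp only [Fin.sum_univ_two, Matrix.cons_val_zero, Matrix.cons_val_one, one_mul]

theorem memLp_sechB_sq {b : ℝ} (hb : b ≠ 0) : MemLp (fun x => sechB b x ^ 2) 2 volume :=
  (weakDerivL2_sechB_sq hb).memLp

theorem inner_sechB_sq {b : ℝ} (hb : b ≠ 0) (f : L2R) :
    ⟪(memLp_sechB_sq hb).toLp _, f⟫ = ∫ x, sechB b x ^ 2 * f x := by
  rw [real_inner_comm, L2R.inner_toLp]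
  simp only [mul_comm]

theorem WeakDerivL2.isWeakDeriv_toLp {f g : ℝ → ℝ} (h : WeakDerivL2 f g) :
    IsWeakDeriv (h.memLp.toLp f) (h.memLp_deriv.toLp g) :=
  h.isWeakDeriv h.memLp.coeFn_toLp h.memLp_deriv.coeFn_toLp

theorem blockDensity_congr {b c ρ : ℝ} {w w' z z' v v' y y' : ℝ → ℝ} (h1 : w =ᵐ[volume] v)
    (h2 : w' =ᵐ[volume] v') (h3 : z =ᵐ[volume] y) (h4 : z' =ᵐ[volume] y') :
    ∫ x, blockDensity b c ρ w w' z z' x = ∫ x, blockDensity b c ρ v v' y y' x := by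
  refine integral_congr_ae ?_
  filter_upwards [h1, h2, h3, h4] with x e1 e2 e3 e4
  simp only [blockDensity, scalarDensity, e1, e2, e3, e4]

/-- The vector `(sech², ρ / 4 sech)`, on which the form of the normalized block is negative. -/
theorem exists_normalized_neg_direction {γ : ℝ} (hγ : 4 < γ) : ∃ e : H1Rn 2,
    schrodingerForm ![1, 12] (normalizedPotential γ) e e < 0 := by
  have h1 := weakDerivL2_sechB_sq (b := 1) one_ne_zero
  have h2 := (BddSmooth.const (normalizedCoupling γ / (4 * 1 ^ 2))).weakDerivL2_mul_sechB
    (b := 1) one_ne_zero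
  refine ⟨WithLp.toLp 2 ![H1R.mk h1.isWeakDeriv_toLp, H1R.mk h2.isWeakDeriv_toLp], ?_⟩
  rw [schrodingerForm_normalizedPotential]
  refine lt_of_eq_of_lt (blockDensity_congr h1.memLp.coeFn_toLp h1.memLp_deriv.coeFn_toLp
    h2.memLp.coeFn_toLp h2.memLp_deriv.coeFn_toLp) ?_
  exact integral_blockDensity_neg one_pos (by linarith) (normalizedCoupling_sq hγ)

theorem normalized_exists_unique_neg {γ : ℝ} (hγ : 4 < γ) :
    ∃ μ < 0, IsSimpleEigenvalue (normalizedHessianBlock γ) μ ∧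
      ∀ ν < 0, IsEigenvalue (normalizedHessianBlock γ) ν → ν = μ := by
  obtain ⟨e, he⟩ := exists_normalized_neg_direction hγ
  rw [normalizedHessianBlock_eq]
  refine matrixSchrodinger_exists_unique_neg one_pos (fun i => ?_) (normalizedPotential_symm γ)
    (WithLp.toLp 2 ![(memLp_sechB_sq (b := 1) one_ne_zero).toLp _, 0]) (fun x hx => ?_) he
  · fin_cases i <;> norm_num
  · rw [schrodingerForm_normalizedPotential]
    refine integral_blockDensity_nonneg one_pos (by linarith) (normalizedCoupling_sq hγ)
      (H1R.isWeakDeriv _).weakDerivL2 (H1R.isWeakDeriv _).weakDerivL2 ?_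
    rw [Fin.sum_univ_two] at hx
    simp only [Matrix.cons_val_zero, Matrix.cons_val_one, inner_zero_left, add_zero] at hx
    rw [← inner_sechB_sq one_ne_zero]
    exact hx

/-- A translation mode `(4 sech² tanh, ρ sech tanh)` in the kernel of the normalized block. -/
theorem exists_normalized_kernel_element {γ : ℝ} (hγ : 4 < γ) :
    ∃ F : (matrixSchrodinger ![1, 12] (normalizedPotential γ)).domain,
      matrixSchrodinger ![1, 12] (normalizedPotential γ) F = 0 ∧
      ((F : L2Rn 2) 0 =ᵐ[volume] fun x => 4 * 1 ^ 2 * Real.tanh (1 * x) * sechB 1 x ^ 2) ∧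
      ((F : L2Rn 2) 1 =ᵐ[volume]
        fun x => normalizedCoupling γ * Real.tanh (1 * x) * sechB 1 x) := by
  set ρ := normalizedCoupling γ
  have hρ : 3 * ρ ^ 2 = 1 ^ 2 * (γ - 4 * 1 ^ 2) := normalizedCoupling_sq hγ
  have hT := bddSmooth_tanh 1
  have hS := bddSmooth_sechB 1
  have w0 : WeakDerivL2 (fun x => 4 * 1 ^ 2 * Real.tanh (1 * x) * sechB 1 x ^ 2)
      fun x => (4 - 12 * (Real.tanh (1 * x) * Real.tanh (1 * x))) * sechB 1 x * sechB 1 x := by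
    refine ((((BddSmooth.const 4).mul hT).mul hS).weakDerivL2_mul_sechB one_ne_zero).congr
      (Filter.Eventually.of_forall fun x => ?_) (Filter.Eventually.of_forall fun x => ?_)
    · simp only; ring
    · simp only; ring
  have w1 : WeakDerivL2
      (fun x => (4 - 12 * (Real.tanh (1 * x) * Real.tanh (1 * x))) * sechB 1 x * sechB 1 x)
      fun x => (-32 + 48 * Real.tanh (1 * x) ^ 2) * Real.tanh (1 * x) * sechB 1 x ^ 2 := by
    refine ((((BddSmooth.const 4).add ((BddSmooth.const (-12)).mul (hT.mul hT))).mul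
      hS).weakDerivL2_mul_sechB one_ne_zero).congr
      (Filter.Eventually.of_forall fun x => ?_) (Filter.Eventually.of_forall fun x => ?_)
    · simp only; ring
    · simp only; ring
  have z0 : WeakDerivL2 (fun x => ρ * Real.tanh (1 * x) * sechB 1 x)
      fun x => (ρ - 2 * ρ * (Real.tanh (1 * x) * Real.tanh (1 * x))) * sechB 1 x := by
    refine (((BddSmooth.const ρ).mul hT).weakDerivL2_mul_sechB one_ne_zero).congr
      (Filter.Eventually.of_forall fun x => ?_) (Filter.Eventually.of_forall fun x => ?_)
    · simp only
    · simp only; ring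
  have z1 : WeakDerivL2
      (fun x => (ρ - 2 * ρ * (Real.tanh (1 * x) * Real.tanh (1 * x))) * sechB 1 x)
      fun x => ρ * (-5 + 6 * Real.tanh (1 * x) ^ 2) * Real.tanh (1 * x) * sechB 1 x := by
    refine (((BddSmooth.const ρ).add ((BddSmooth.const (-2 * ρ)).mul
      (hT.mul hT))).weakDerivL2_mul_sechB one_ne_zero).congr
      (Filter.Eventually.of_forall fun x => ?_) (Filter.Eventually.of_forall fun x => ?_)
    · simp only; ring
    · simp only; ring
  obtain ⟨F, hF, hLF⟩ := exists_matrixSchrodinger_apply_eq ![1, 12] (normalizedPotential γ)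
    (f := ![w0.memLp.toLp _, z0.memLp.toLp _]) (g := ![w1.memLp.toLp _, z1.memLp.toLp _])
    (h := ![w1.memLp_deriv.toLp _, z1.memLp_deriv.toLp _])
    (fun i => by
      fin_cases i
      · exact w0.isWeakDeriv_toLp
      · exact z0.isWeakDeriv_toLp)
    (fun i => by
      fin_cases i
      · exact w1.isWeakDeriv_toLp
      · exact z1.isWeakDeriv_toLp)
  have c0 : (F : L2Rn 2) 0 = w0.memLp.toLp _ := by rw [hF]; rfl
  have c1 : (F : L2Rn 2) 1 = z0.memLp.toLp _ := by rw [hF]; rfl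
  refine ⟨F, ?_, ?_, ?_⟩
  · ext1 i
    rw [hLF, Fin.sum_univ_two]
    have m0 : ∀ i, mulOp (normalizedPotential γ i 0) (w0.memLp.toLp _) =ᵐ[volume]
        fun x => normalizedPotential γ i 0 x * (4 * 1 ^ 2 * Real.tanh (1 * x) * sechB 1 x ^ 2) := by
      intro i
      filter_upwards [mulOp_coeFn (normalizedPotential γ i 0) (w0.memLp.toLp _),
        w0.memLp.coeFn_toLp] with x h1 h2
      rw [h1, h2]
    have m1 : ∀ i, mulOp (normalizedPotential γ i 1) (z0.memLp.toLp _) =ᵐ[volume]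
        fun x => normalizedPotential γ i 1 x * (ρ * Real.tanh (1 * x) * sechB 1 x) := by
      intro i
      filter_upwards [mulOp_coeFn (normalizedPotential γ i 1) (z0.memLp.toLp _),
        z0.memLp.coeFn_toLp] with x h1 h2
      rw [h1, h2]
    refine Lp.ext ?_
    fin_cases i
    · simp only [Fin.zero_eta, Matrix.cons_val_zero, Matrix.cons_val_one, PiLp.zero_apply, one_smul]
      filter_upwards [Lp.coeFn_add (-w1.memLp_deriv.toLp _)
          (mulOp (normalizedPotential γ 0 0) (w0.memLp.toLp _) +
            mulOp (normalizedPotential γ 0 1) (z0.memLp.toLp _)),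
        Lp.coeFn_add (mulOp (normalizedPotential γ 0 0) (w0.memLp.toLp _))
          (mulOp (normalizedPotential γ 0 1) (z0.memLp.toLp _)),
        Lp.coeFn_neg (w1.memLp_deriv.toLp _), w1.memLp_deriv.coeFn_toLp, m0 0, m1 0,
        Lp.coeFn_zero ℝ 2 volume] with x e1 e2 e3 e4 e5 e6 e7
      rw [e1, Pi.add_apply, e2, Pi.add_apply, e3, Pi.neg_apply, e4, e5, e6, e7, Pi.zero_apply,
        normalizedPotential_zero_zero, normalizedPotential_zero_one]
      have hS2 := sechB_sq 1 x
      linear_combination (-48 * Real.tanh (1 * x) * sechB 1 x ^ 2) * hS2 -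
        4 * Real.tanh (1 * x) * sechB 1 x ^ 2 * hρ
    · simp only [Fin.mk_one, Matrix.cons_val_zero, Matrix.cons_val_one, PiLp.zero_apply]
      filter_upwards [Lp.coeFn_add (-((12 : ℝ) • z1.memLp_deriv.toLp _))
          (mulOp (normalizedPotential γ 1 0) (w0.memLp.toLp _) +
            mulOp (normalizedPotential γ 1 1) (z0.memLp.toLp _)),
        Lp.coeFn_add (mulOp (normalizedPotential γ 1 0) (w0.memLp.toLp _))
          (mulOp (normalizedPotential γ 1 1) (z0.memLp.toLp _)),
        Lp.coeFn_neg ((12 : ℝ) • z1.memLp_deriv.toLp _),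
        Lp.coeFn_smul (12 : ℝ) (z1.memLp_deriv.toLp _), z1.memLp_deriv.coeFn_toLp, m0 1, m1 1,
        Lp.coeFn_zero ℝ 2 volume] with x e1 e2 e3 e3' e4 e5 e6 e7
      rw [e1, Pi.add_apply, e2, Pi.add_apply, e3, Pi.neg_apply, e3', Pi.smul_apply, e4, e5, e6, e7,
        Pi.zero_apply, normalizedPotential_symm, normalizedPotential_zero_one,
        normalizedPotential_one_one, smul_eq_mul]
      have hS2 := sechB_sq 1 x
      linear_combination (-72 * ρ * Real.tanh (1 * x) * sechB 1 x) * hS2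
  · rw [c0]; exact w0.memLp.coeFn_toLp
  · rw [c1]; exact z0.memLp.coeFn_toLp

/-- A kernel element satisfies the constraint: otherwise the form would be negative at its
projection onto the constraint hyperplane along a negative direction. -/
theorem normalized_kernel_constraint {γ : ℝ} (hγ : 4 < γ)
    {f : (matrixSchrodinger ![1, 12] (normalizedPotential γ)).domain}
    (hf : matrixSchrodinger ![1, 12] (normalizedPotential γ) f = 0) :
    ∫ x, sechB 1 x ^ 2 * (f : L2Rn 2) 0 x = 0 := by
  obtain ⟨e, he⟩ := exists_normalized_neg_direction hγ
  obtain ⟨y, hy⟩ := exists_H1Rn_of_mem_H2Rn (f := (f : L2Rn 2)) f.2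
  set B := schrodingerForm (n := 2) ![1, 12] (normalizedPotential γ) with hB
  have hBy : ∀ x, B y x = 0 := fun x => by
    rw [hB, ← inner_matrixSchrodinger f hy (g := WithLp.toLp 2 fun i => H1R.val (x i))
      fun i => rfl]
    rw [hf, inner_zero_left]
  have hpos : ∀ x : H1Rn 2, ∫ t, sechB 1 t ^ 2 * H1R.val (x 0) t = 0 → 0 ≤ B x x := by
    intro x hx
    rw [hB, schrodingerForm_normalizedPotential]
    exact integral_blockDensity_nonneg one_pos (by linarith) (normalizedCoupling_sq hγ)
      (H1R.isWeakDeriv _).weakDerivL2 (H1R.isWeakDeriv _).weakDerivL2 hx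
  set l : H1Rn 2 → ℝ := fun x => ∫ t, sechB 1 t ^ 2 * H1R.val (x 0) t with hl
  have hlin : ∀ (x x' : H1Rn 2) (s : ℝ), l (x + s • x') = l x + s * l x' := fun x x' s => by
    simp only [hl, ← inner_sechB_sq (b := 1) one_ne_zero, PiLp.add_apply, PiLp.smul_apply, map_add,
      map_smul, inner_add_right, inner_smul_right]
  have hle : l e ≠ 0 := fun h => absurd (hpos e h) (not_le.2 he)
  have hly : l y = 0 := by
    by_contra hne
    have h1 := hpos (y + (-(l y / l e)) • e) (by
      change l _ = 0
      rw [hlin]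
      field_simp
      ring)
    rw [bilin_apply_add_smul B (schrodingerForm_symm (normalizedPotential_symm γ)), hBy, hBy] at h1
    have h2 : 0 < (-(l y / l e)) ^ 2 := by
      rw [neg_sq]
      exact sq_pos_of_ne_zero (div_ne_zero hne hle)
    nlinarith [mul_pos h2 (neg_pos.2 he)]
  rw [← hly, hl]
  simp only [(hy 0).1]

theorem normalized_isSimpleEigenvalue_zero {γ : ℝ} (hγ : 4 < γ) :
    IsSimpleEigenvalue (normalizedHessianBlock γ) 0 := by
  rw [normalizedHessianBlock_eq]
  obtain ⟨F, hLF, hF0, hF1⟩ := exists_normalized_kernel_element hγ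
  set ρ := normalizedCoupling γ with hρdef
  have hρ0 : 0 < ρ := normalizedCoupling_pos hγ
  have hFne : (F : L2Rn 2) ≠ 0 := by
    intro h0
    have h1 : (F : L2Rn 2) 1 =ᵐ[volume] fun _ => (0 : ℝ) := by
      rw [h0]
      exact Lp.coeFn_zero ℝ 2 volume
    have h2 := Continuous.ae_eq_iff_eq volume
      ((continuous_const.mul (contDiff_tanh_mul 1).continuous).mul (sechB 1).continuous)
      continuous_const |>.1 (hF1.symm.trans h1)
    have h3 := congrFun h2 1
    have h4 : 0 < Real.tanh (1 * 1) := by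
      rw [Real.tanh_eq_sinh_div_cosh]
      exact div_pos (Real.sinh_pos_iff.2 (by norm_num)) (Real.cosh_pos _)
    have := mul_pos (mul_pos hρ0 h4) (sechB_pos 1 1)
    exact this.ne' h3
  refine isSimpleEigenvalue_of_symmetric
    (matrixSchrodinger_symmetric (normalizedPotential_symm γ)) hFne
    ⟨F, rfl, by rw [zero_smul]; exact hLF⟩ ?_
  rintro _ ⟨f, rfl, hf⟩
  rw [zero_smul] at hf
  have hcon := normalized_kernel_constraint hγ hf
  obtain ⟨y, hy⟩ := exists_H1Rn_of_mem_H2Rn (f := (f : L2Rn 2)) f.2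
  have hq : ∫ t, blockDensity 1 γ ρ (H1R.val (y 0)) (H1R.der (y 0)) (H1R.val (y 1))
      (H1R.der (y 1)) t = 0 := by
    rw [← schrodingerForm_normalizedPotential, ← inner_matrixSchrodinger f hy fun i => (hy i).1]
    rw [hf, inner_zero_left]
  obtain ⟨a, β, hw, hz⟩ := ae_eq_of_integral_blockDensity_eq_zero one_pos (by linarith)
    (normalizedCoupling_sq hγ) (H1R.isWeakDeriv _).weakDerivL2 (H1R.isWeakDeriv _).weakDerivL2
    (by rw [(hy 0).1]; exact hcon) hq
  rw [(hy 0).1] at hw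
  rw [(hy 1).1] at hz
  -- The remainder `g = f - a F = (0, β sech)` is a kernel element, and the first component of the
  -- equation reads `-12 ρ β sech² = 0`.
  set g := f - a • F with hg
  have hLg : matrixSchrodinger ![1, 12] (normalizedPotential γ) g = 0 := by
    rw [hg, LinearPMap.map_sub, LinearPMap.map_smul, hf, hLF, smul_zero, sub_zero]
  have hgi : ∀ i, (g : L2Rn 2) i = (f : L2Rn 2) i - a • (F : L2Rn 2) i := fun i => by
    rw [hg, Submodule.coe_sub, Submodule.coe_smul, PiLp.sub_apply, PiLp.smul_apply]
  have hg0 : (g : L2Rn 2) 0 = 0 := by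
    refine Lp.ext ?_
    rw [hgi]
    filter_upwards [Lp.coeFn_sub ((f : L2Rn 2) 0) (a • (F : L2Rn 2) 0),
      Lp.coeFn_smul a ((F : L2Rn 2) 0), hw, hF0, Lp.coeFn_zero ℝ 2 volume] with x e1 e2 e3 e4 e5
    rw [e1, Pi.sub_apply, e2, Pi.smul_apply, e3, e4, e5, smul_eq_mul, sub_self, Pi.zero_apply]
  have hg1 : ∀ᵐ x, (g : L2Rn 2) 1 x = β * sechB 1 x := by
    rw [hgi]
    filter_upwards [Lp.coeFn_sub ((f : L2Rn 2) 1) (a • (F : L2Rn 2) 1),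
      Lp.coeFn_smul a ((F : L2Rn 2) 1), hz, hF1] with x e1 e2 e3 e4
    rw [e1, Pi.sub_apply, e2, Pi.smul_apply, e3, e4, smul_eq_mul]
    ring
  have hβ : β = 0 := by
    have h1 : (matrixSchrodinger ![1, 12] (normalizedPotential γ) g : L2Rn 2) 0 = 0 := by
      rw [hLg]; rfl
    have h2 : deriv2 ⟨(g : L2Rn 2) 0, g.2 0⟩ = 0 := by
      have : (⟨(g : L2Rn 2) 0, g.2 0⟩ : H2R) = 0 := Subtype.ext hg0
      rw [this, map_zero]
    have h3 : (matrixSchrodinger ![1, 12] (normalizedPotential γ) g : L2Rn 2) 0 =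
        mulOp (normalizedPotential γ 0 1) ((g : L2Rn 2) 1) := by
      rw [matrixSchrodinger_apply, Fin.sum_univ_two, h2, hg0]
      simp
    rw [h1] at h3
    have h4 : (fun _ => (0 : ℝ)) =ᵐ[volume] fun x => -(12 * ρ) * sechB 1 x * (β * sechB 1 x) := by
      have h5 : (0 : L2R) =ᵐ[volume] mulOp (normalizedPotential γ 0 1) ((g : L2Rn 2) 1) := by
        rw [← h3]
      filter_upwards [h5, Lp.coeFn_zero ℝ 2 volume, mulOp_coeFn (normalizedPotential γ 0 1)
        ((g : L2Rn 2) 1), hg1] with x e1 e2 e3 e4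
      rw [e2, Pi.zero_apply] at e1
      rw [e1, e3, e4, normalizedPotential_zero_one]
    have h6 := congrFun (Continuous.ae_eq_iff_eq volume continuous_const
      ((continuous_const.mul (sechB 1).continuous).mul
        (continuous_const.mul (sechB 1).continuous)) |>.1 h4) 0
    have h7 := sechB_pos 1 0
    simp only [Pi.mul_apply] at h6
    have h8 : 12 * ρ * sechB 1 0 * sechB 1 0 * β = 0 := by linarith
    exact (mul_eq_zero.1 h8).resolve_left (by positivity)
  refine ⟨a, ?_⟩
  have hg1' : (g : L2Rn 2) 1 = 0 := by
    refine Lp.ext ?_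
    filter_upwards [hg1, Lp.coeFn_zero ℝ 2 volume] with x e1 e2
    rw [e1, e2, hβ, zero_mul, Pi.zero_apply]
  ext1 i
  rw [PiLp.smul_apply]
  have : (g : L2Rn 2) i = 0 := by
    fin_cases i
    · exact hg0
    · exact hg1'
  rw [hgi, sub_eq_zero] at this
  exact this.symm

/-! ### The constrained Hessian -/

/-- The coupling constant `ρ` of the Hessian at the exact solution, for which `A = 6 ρ sech` and
`3 ρ² = b² (c - 4 b²)` with `b = √(-Ω)`. -/
noncomputable def exactCoupling (c Ω : ℝ) : ℝ := √(-12 * Ω * (c + 4 * Ω)) / 6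

theorem exactU_apply {Ω : ℝ} (hΩ : Ω < 0) (x : ℝ) :
    exactU Ω x = 12 * √(-Ω) ^ 2 * sechB (√(-Ω)) x ^ 2 := by
  rw [Real.sq_sqrt (by linarith)]
  simp [exactU]

theorem exactA_apply (c Ω x : ℝ) :
    exactA c Ω x = 6 * exactCoupling c Ω * sechB (√(-Ω)) x := by
  simp only [exactA, exactCoupling, BoundedContinuousFunction.smul_apply, smul_eq_mul]
  ring

theorem four_mul_sq_lt {c Ω : ℝ} (hΩ : Ω < 0) (hc : 4 < c / |Ω|) : 4 * √(-Ω) ^ 2 < c := by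
  rw [lt_div_iff₀ (abs_pos.2 hΩ.ne), abs_of_neg hΩ] at hc
  rwa [Real.sq_sqrt (by linarith)]

theorem exactCoupling_sq {c Ω : ℝ} (hΩ : Ω < 0) (hc : 4 < c / |Ω|) :
    3 * exactCoupling c Ω ^ 2 = √(-Ω) ^ 2 * (c - 4 * √(-Ω) ^ 2) := by
  have h := four_mul_sq_lt hΩ hc
  have h2 : √(-Ω) ^ 2 = -Ω := Real.sq_sqrt (by linarith)
  rw [h2] at h ⊢
  have h3 : 0 ≤ -12 * Ω * (c + 4 * Ω) := mul_nonneg (by linarith) (by linarith)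
  rw [exactCoupling, div_pow, Real.sq_sqrt h3]
  ring

theorem exactCoupling_pos {c Ω : ℝ} (hΩ : Ω < 0) (hc : 4 < c / |Ω|) : 0 < exactCoupling c Ω := by
  have h := four_mul_sq_lt hΩ hc
  rw [Real.sq_sqrt (by linarith)] at h
  exact div_pos (Real.sqrt_pos.2 (mul_pos (by linarith) (by linarith))) (by norm_num)

theorem deriv_exactU {Ω : ℝ} (hΩ : Ω < 0) (x : ℝ) : deriv (exactU Ω) x =
    12 * √(-Ω) ^ 2 * (-(2 * √(-Ω) * Real.tanh (√(-Ω) * x)) * sechB (√(-Ω)) x ^ 2) := by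
  have e : (exactU Ω : ℝ → ℝ) = fun x => 12 * √(-Ω) ^ 2 * sechB (√(-Ω)) x ^ 2 :=
    funext (exactU_apply hΩ)
  rw [e]
  exact ((hasDerivAt_sechB_sq _ x).const_mul _).deriv

theorem deriv_exactA (c Ω x : ℝ) : deriv (exactA c Ω) x =
    6 * exactCoupling c Ω * (-√(-Ω) * Real.tanh (√(-Ω) * x) * sechB (√(-Ω)) x) := by
  have e : (exactA c Ω : ℝ → ℝ) = fun x => 6 * exactCoupling c Ω * sechB (√(-Ω)) x :=
    funext (exactA_apply c Ω)
  rw [e]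
  exact ((hasDerivAt_sechB _ x).const_mul _).deriv

/-- The quadratic form of the Hessian is the coupled block energy in `(w, z₁)` plus the scalar
energy in `z₂`. -/
theorem exists_inner_hessian_eq {c Ω : ℝ} (hΩ : Ω < 0)
    (f : (hessian (1 / 6) 1 c Ω (exactU Ω) (exactA c Ω)).domain) :
    ∃ w' z' y' : L2R, IsWeakDeriv ((f : L2Rn 3) 0) w' ∧ IsWeakDeriv ((f : L2Rn 3) 1) z' ∧
      IsWeakDeriv ((f : L2Rn 3) 2) y' ∧
      ⟪hessian (1 / 6) 1 c Ω (exactU Ω) (exactA c Ω) f, (f : L2Rn 3)⟫ =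
        (∫ x, blockDensity (√(-Ω)) c (exactCoupling c Ω) ((f : L2Rn 3) 0) w'
          ((f : L2Rn 3) 1) z' x) +
        12 * ∫ x, scalarDensity (√(-Ω)) ((f : L2Rn 3) 2) y' x := by
  obtain ⟨x, hx⟩ := exists_H1Rn_of_mem_H2Rn (f := (f : L2Rn 3)) f.2
  have hx' : ∀ i, H1R.val (x i) = (f : L2Rn 3) i := fun i => (hx i).1
  refine ⟨H1R.der (x 0), H1R.der (x 1), H1R.der (x 2), ?_, ?_, ?_, ?_⟩
  · rw [← hx']; exact H1R.isWeakDeriv _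
  · rw [← hx']; exact H1R.isWeakDeriv _
  · rw [← hx']; exact H1R.isWeakDeriv _
  have hsq : √(-Ω) ^ 2 = -Ω := Real.sq_sqrt (by linarith)
  have h22 : ∀ t, ((2 * 1 / (1 / 6) : ℝ) • (-(Ω • 1) - (1 / 6 : ℝ) • exactU Ω) : ℝ →ᵇ ℝ) t =
      12 * (√(-Ω) ^ 2 - 2 * √(-Ω) ^ 2 * sechB (√(-Ω)) t ^ 2) := by
    intro t
    simp only [BoundedContinuousFunction.smul_apply, BoundedContinuousFunction.sub_apply,
      BoundedContinuousFunction.neg_apply, BoundedContinuousFunction.coe_one, Pi.one_apply,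
      smul_eq_mul, exactU_apply hΩ, hsq]
    ring
  have h11 : ∀ t, (c • 1 - exactU Ω : ℝ →ᵇ ℝ) t =
      c - 12 * √(-Ω) ^ 2 * sechB (√(-Ω)) t ^ 2 := by
    intro t
    simp only [BoundedContinuousFunction.smul_apply, BoundedContinuousFunction.sub_apply,
      BoundedContinuousFunction.coe_one, Pi.one_apply, smul_eq_mul, exactU_apply hΩ, mul_one]
  have h12 : ∀ t, ((-(2 * 1) : ℝ) • exactA c Ω : ℝ →ᵇ ℝ) t =
      -(12 * exactCoupling c Ω) * sechB (√(-Ω)) t := by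
    intro t
    simp only [BoundedContinuousFunction.smul_apply, smul_eq_mul, exactA_apply]
    ring
  have hzero : ∀ g : L2R, mulOp 0 g = 0 := by
    intro g
    refine Lp.ext ?_
    filter_upwards [mulOp_coeFn 0 g, Lp.coeFn_zero ℝ 2 volume] with t e1 e2
    rw [e1, e2]
    simp
  rw [← inner_add_inner_eq_integral_blockDensity h11 h12 h12 h22,
    ← inner_add_inner_eq_integral_scalarDensity h22]
  refine (inner_matrixSchrodinger f hx fun i => (hx i).1).trans ?_
  rw [schrodingerForm_apply]
  simp only [Fin.sum_univ_three, hx']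
  simp only [Matrix.of_apply, Matrix.cons_val_zero, Matrix.cons_val_one, Matrix.cons_val, hzero,
    inner_zero_left]
  ring

/-- The constraint `⟪A, z₁⟫ = 0` removes the phase mode: it fixes the coefficient of `sech`. -/
theorem coeff_eq_zero_of_integral_sechB_mul_eq_zero {b : ℝ} (hb : b ≠ 0) {a ρ β : ℝ} {z : L2R}
    (hz : ∀ᵐ x, z x = a * (ρ * Real.tanh (b * x) * sechB b x) + β * sechB b x)
    (h : ∫ x, sechB b x * z x = 0) : β = 0 := by
  have hS := (memLp_sechB hb).integrable_sq
  have hT : Integrable fun x => Real.tanh (b * x) * sechB b x ^ 2 :=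
    ((bddSmooth_tanh b).integrable_mul_mul (memLp_sechB hb) (memLp_sechB hb)).congr
      (Filter.Eventually.of_forall fun x => by simp only; ring)
  have e : ∀ᵐ x, sechB b x * z x =
      a * ρ * (Real.tanh (b * x) * sechB b x ^ 2) + β * sechB b x ^ 2 := by
    filter_upwards [hz] with x hx
    rw [hx]
    ring
  rw [integral_congr_ae e, integral_add (hT.const_mul _) (hS.const_mul _), integral_const_mul,
    integral_const_mul, integral_tanh_mul_sechB_sq hb, mul_zero, zero_add] at h
  exact (mul_eq_zero.1 h).resolve_right (integral_sechB_sq_pos hb).ne'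

theorem hessian_constrained {c Ω : ℝ} (hΩ : Ω < 0) (hc : 4 < c / |Ω|)
    (f : (hessian (1 / 6) 1 c Ω (exactU Ω) (exactA c Ω)).domain)
    (hU : (∫ ξ, exactU Ω ξ * (f : L2Rn 3) 0 ξ) = 0)
    (hA : (∫ ξ, exactA c Ω ξ * (f : L2Rn 3) 1 ξ) = 0) :
    0 ≤ ⟪hessian (1 / 6) 1 c Ω (exactU Ω) (exactA c Ω) f, (f : L2Rn 3)⟫ ∧
      (⟪hessian (1 / 6) 1 c Ω (exactU Ω) (exactA c Ω) f, (f : L2Rn 3)⟫ = 0 ↔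
        ∃ a b : ℝ,
          (∀ᵐ ξ, (f : L2Rn 3) 0 ξ = a * deriv (exactU Ω) ξ) ∧
          (∀ᵐ ξ, (f : L2Rn 3) 1 ξ = a * deriv (exactA c Ω) ξ) ∧
          (∀ᵐ ξ, (f : L2Rn 3) 2 ξ = b * exactA c Ω ξ)) := by
  obtain ⟨w', z', y', hw, hz, hy, hq⟩ := exists_inner_hessian_eq hΩ f
  have hb : 0 < √(-Ω) := Real.sqrt_pos.2 (by linarith)
  have hc4 := four_mul_sq_lt hΩ hc
  have hc0 : 0 < c := lt_of_le_of_lt (by positivity) hc4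
  have hρ := exactCoupling_sq hΩ hc
  have hρ0 := exactCoupling_pos hΩ hc
  set b := √(-Ω) with hbdef
  set ρ := exactCoupling c Ω with hρdef
  have hU' : ∫ x, sechB b x ^ 2 * (f : L2Rn 3) 0 x = 0 := by
    simp only [exactU_apply hΩ, mul_assoc, integral_const_mul] at hU
    simp only [← hbdef] at hU
    have h12 : (12 : ℝ) ≠ 0 := by norm_num
    exact (mul_eq_zero.1 ((mul_eq_zero.1 hU).resolve_left h12)).resolve_left (by positivity)
  have hA' : ∫ x, sechB b x * (f : L2Rn 3) 1 x = 0 := by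
    simp only [exactA_apply, mul_assoc, integral_const_mul] at hA
    simp only [← hbdef, ← hρdef] at hA
    have h6 : (6 : ℝ) ≠ 0 := by norm_num
    exact (mul_eq_zero.1 ((mul_eq_zero.1 hA).resolve_left h6)).resolve_left hρ0.ne'
  have h1 := integral_blockDensity_nonneg hb hc0 hρ hw.weakDerivL2 hz.weakDerivL2 hU'
  have h2 := integral_scalarDensity_nonneg (b := b) hy.weakDerivL2
  rw [hq]
  refine ⟨by linarith, fun h0 => ?_, ?_⟩
  · obtain ⟨a, β, hw0, hz0⟩ := ae_eq_of_integral_blockDensity_eq_zero hb hc0 hρ hw.weakDerivL2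
      hz.weakDerivL2 hU' (by linarith)
    obtain ⟨κ, hy0⟩ := ae_eq_of_integral_scalarDensity_eq_zero (b := b) hy.weakDerivL2 (by linarith)
    have hβ := coeff_eq_zero_of_integral_sechB_mul_eq_zero hb.ne' hz0 hA'
    refine ⟨-a / (6 * b), κ / (6 * ρ), ?_, ?_, ?_⟩
    · filter_upwards [hw0] with x hx
      rw [hx, deriv_exactU hΩ, ← hbdef]
      field_simp
      ring
    · filter_upwards [hz0] with x hx
      rw [hx, deriv_exactA, ← hbdef, ← hρdef, hβ]
      field_simp
      ring
    · filter_upwards [hy0] with x hx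
      rw [hx, exactA_apply, ← hbdef, ← hρdef]
      field_simp
  · rintro ⟨a, κ, hw0, hz0, hy0⟩
    rw [integral_blockDensity_eq_zero hb hρ hw.weakDerivL2 hz.weakDerivL2 (a := -(6 * b * a)) ?_ ?_,
      integral_scalarDensity_eq_zero hb.ne' hy.weakDerivL2 (β := κ * (6 * ρ)) ?_]
    · simp
    · filter_upwards [hy0] with x hx
      rw [hx, exactA_apply, ← hbdef, ← hρdef]
      ring
    · filter_upwards [hw0] with x hx
      rw [hx, deriv_exactU hΩ, ← hbdef]
      ring
    · filter_upwards [hz0] with x hx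
      rw [hx, deriv_exactA, ← hbdef, ← hρdef]
      ring

theorem mainTheorem5 :
    -- exactly one negative eigenvalue, simple; and zero is a simple eigenvalue
    (∀ γ : ℝ, 4 < γ →
      (∃ μ : ℝ, μ < 0 ∧ IsSimpleEigenvalue (normalizedHessianBlock γ) μ ∧
        ∀ ν : ℝ, ν < 0 → IsEigenvalue (normalizedHessianBlock γ) ν → ν = μ) ∧
      IsSimpleEigenvalue (normalizedHessianBlock γ) 0) ∧
    -- the constrained Hessian is nonnegative, degenerate only along the two symmetries
    (∀ c Ω : ℝ, Ω < 0 → 4 < c / |Ω| →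
      ∀ f : (hessian (1 / 6) 1 c Ω (exactU Ω) (exactA c Ω)).domain,
        (∫ ξ, exactU Ω ξ * (f : L2Rn 3) 0 ξ) = 0 →
        (∫ ξ, exactA c Ω ξ * (f : L2Rn 3) 1 ξ) = 0 →
        0 ≤ ⟪hessian (1 / 6) 1 c Ω (exactU Ω) (exactA c Ω) f, (f : L2Rn 3)⟫ ∧
        (⟪hessian (1 / 6) 1 c Ω (exactU Ω) (exactA c Ω) f, (f : L2Rn 3)⟫ = 0 ↔
          ∃ a b : ℝ,
            (∀ᵐ ξ, (f : L2Rn 3) 0 ξ = a * deriv (exactU Ω) ξ) ∧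
            (∀ᵐ ξ, (f : L2Rn 3) 1 ξ = a * deriv (exactA c Ω) ξ) ∧
            (∀ᵐ ξ, (f : L2Rn 3) 2 ξ = b * exactA c Ω ξ))) := by

  exact ⟨fun γ hγ => ⟨normalized_exists_unique_neg hγ, normalized_isSimpleEigenvalue_zero hγ⟩,
    fun c Ω hΩ hc f hU hA => hessian_constrained hΩ hc f hU hA⟩
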